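/- There exist absolute constants $c_0, C, c > 0$ such that the following holds. Let $X$ be a fixed nonzero real $n \times p$ matrix with Frobenius norm $\|X\|_F$, spectral norm $\|X\|$ and stable rank $\mathrm{sr}(X) = \|X\|_F^2/\|X\|^2$. Let $\beta \in (0,1]$ and $K > 0$. Let $\Omega$ be a random $p \times d$ matrix with i.i.d. Bernoulli($\beta$) entries ($1$ with probability $\beta$, and $0$ otherwise), and let $\Gamma = (\Gamma_{ij})$ be a random $p \times d$ matrix, independent of $\Omega$, with independent entries satisfying $\mathbb{E}[\Gamma_{ij}] = 0$, $\mathbb{E}[\Gamma_{ij}^2] = 1$ and $\|\Gamma_{ij}\|_{\psi_2} \le K$, where $\|x\|_{\psi_2} = \sup_{a \ge 1} a^{-1/2} (\mathbb{E}|x|^a)^{1/a}$. Let $\hat R = \Omega \odot \Gamma$ be their entrywise product and $R = \hat R/(c_0 \sqrt{\beta})$. Let $\epsilon \in (0,1)$ and let $k \ge 1$ be an integer satisfying $$\mathrm{sr}(X) \ge C K^4 \frac{k}{\beta \epsilon^2} \max\Bigl\{1, \log\Bigl(\frac{d}{k}\Bigr)\Bigr\}.$$ Then with probability at least $1 - \exp(-c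 \beta \epsilon^2\, \mathrm{sr}(X)/K^4)$ the matrix $XR$ satisfies the $(k,\epsilon)$-restricted isometry property, that is, for every unit vector $u \in \mathbb{R}^d$ with at most $k$ nonzero coordinates, $$(1-\epsilon)\|X\|_F \le \|XRu\| \le (1+\epsilon)\|X\|_F.$$ -/

import Mathlib

open MeasureTheory ProbabilityTheory

open scoped ENNReal Matrix

/-- The Frobenius norm `‖M‖_F` of a real matrix. -/
noncomputable def frobNorm {m n : ℕ} (M : Matrix (Fin m) (Fin n) ℝ) : ℝ :=
  Real.sqrt (∑ i, ∑ j, M i j ^ 2)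

section
open scoped Matrix.Norms.L2Operator

/-- The spectral norm `‖M‖` of a real matrix (its operator norm between Euclidean spaces). -/
noncomputable def specNorm {m n : ℕ} (M : Matrix (Fin m) (Fin n) ℝ) : ℝ := ‖M‖

end

/-- The stable rank `sr(M) = ‖M‖_F² / ‖M‖²`. -/
noncomputable def stableRank {m n : ℕ} (M : Matrix (Fin m) (Fin n) ℝ) : ℝ :=
  frobNorm M ^ 2 / specNorm M ^ 2

/-- `Σ_k`: the unit vectors of `ℝ^d` with at most `k` nonzero coordinates. -/
def sparseSphere (d k : ℕ) : Set (EuclideanSpace ℝ (Fin d)) :=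
  {u | ‖u‖ = 1 ∧ {j | u j ≠ 0}.ncard ≤ k}

/-- `(k, ε)`-RIP for a product `X R`, normalised by `‖X‖_F`. -/
def ProductRIP {n p d : ℕ} (X : Matrix (Fin n) (Fin p) ℝ) (R : Matrix (Fin p) (Fin d) ℝ)
    (k : ℕ) (ε : ℝ) : Prop :=
  ∀ u ∈ sparseSphere d k,
    (1 - ε) * frobNorm X ≤ ‖Matrix.toEuclideanLin (X * R) u‖ ∧
      ‖Matrix.toEuclideanLin (X * R) u‖ ≤ (1 + ε) * frobNorm X

/-- The `ψ₂`-norm `sup_{a ≥ 1} a^{-1/2} (𝔼 |x|^a)^{1/a}`, with values in `[0, ∞]`;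
it is finite exactly for subgaussian `x`. -/
noncomputable def psiTwoNorm {S : Type*} [MeasurableSpace S] (x : S → ℝ) (μ : Measure S) : ℝ≥0∞ :=
  ⨆ (a : ℝ) (_ : 1 ≤ a), ENNReal.ofReal (a ^ (-(1 / 2) : ℝ)) * eLpNorm x (ENNReal.ofReal a) μ

/-- The data of the Bernoulli-subgaussian model: `W` is a matrix of i.i.d. Bernoulli(`β`) entries,
`G` is a matrix of independent centered entries of unit variance whose `ψ₂`-norms are at most `K`,
and `W`, `G` are independent. The sparse random matrix itself is `W ⊙ G`. -/
structure IsBernoulliSubgaussian {S : Type*} [MeasurableSpace S] (μ : Measure S) {p d : ℕ}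
    (W G : S → Matrix (Fin p) (Fin d) ℝ) (β : unitInterval) (K : ℝ) : Prop where
  measurable_W : ∀ i j, Measurable fun s => W s i j
  measurable_G : ∀ i j, Measurable fun s => G s i j
  law_W : ∀ i j, HasLaw (fun s => W s i j) (bernoulliMeasure (1 : ℝ) 0 β) μ
  indep_W : iIndepFun (fun (e : Fin p × Fin d) s => W s e.1 e.2) μ
  indep_G : iIndepFun (fun (e : Fin p × Fin d) s => G s e.1 e.2) μ
  indep_W_G : IndepFun (fun s (e : Fin p × Fin d) => W s e.1 e.2)
    (fun s (e : Fin p × Fin d) => G s e.1 e.2) μ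
  mean_G : ∀ i j, ∫ s, G s i j ∂μ = 0
  var_G : ∀ i j, ∫ s, G s i j ^ 2 ∂μ = 1
  psiTwo_G : ∀ i j, psiTwoNorm (fun s => G s i j) μ ≤ ENNReal.ofReal K

/-! The constant c₀ = 1 works. For a fixed unit vector y, β‖XRy‖² is a quadratic form in the entries
of `W ⊙ G`. Its matrix is A = MᵀM with M = X ⊗ yᵀ, so tr A = ‖X‖_F² and A ≤ L with L = ‖X‖²; hence
tr A / L is the stable rank of X. The core is a Hanson-Wright inequality for sparse vectors
(`SubgaussianLaw.measure_sparse_quadratic_le`): the form deviates from its mean β tr A by a relative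
amount t with probability at most 2 exp(-t²β tr A / (2048τ²L)), where τ is of order K².

To get β to the first power, the form is split. The diagonal part is a sum of independent centered
terms, each with log-moment generating function of order βτ²l²A_ii². The off-diagonal part is
decoupled by averaging over subsets I of the coordinates. With the Bernoulli variables frozen,
integrating the entries in I and then those outside leaves an exponent linear in the w_j², and only
then are the Bernoulli variables averaged, which produces the factor β. Positivity of A allows L tr
A to replace ‖A‖_F² throughout.

Uniformity over sparse vectors comes from half-nets on coordinate subspaces (`exists_sparse_net`),
exp(O(k max(1, log(d/k)))) points in all. A deviation bound on the net extends to all sparse unit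
vectors with a loss of 32, and the stable rank hypothesis pays for the union bound. -/

/-- The exponential of a real number, as an extended nonnegative real. -/
noncomputable def expE (x : ℝ) : ℝ≥0∞ := ENNReal.ofReal (Real.exp x)

/-! ### Exponentials in [0, ∞] and scalar inequalities. -/

@[fun_prop]
lemma measurable_expE : Measurable expE := by unfold expE; fun_prop

lemma expE_add (x y : ℝ) : expE (x + y) = expE x * expE y := by
  rw [expE, Real.exp_add, ENNReal.ofReal_mul (Real.exp_pos _).le]; rfl

lemma expE_zero : expE 0 = 1 := by simp [expE]

lemma expE_sum {ι : Type*} (s : Finset ι) (f : ι → ℝ) :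
    expE (∑ i ∈ s, f i) = ∏ i ∈ s, expE (f i) := by
  rw [expE, Real.exp_sum, ENNReal.ofReal_prod_of_nonneg fun _ _ => (Real.exp_pos _).le]; rfl

lemma expE_le_expE {x y : ℝ} (h : x ≤ y) : expE x ≤ expE y :=
  ENNReal.ofReal_le_ofReal (Real.exp_le_exp.2 h)

/-- The linear term stands alone, so it vanishes on integrating a centered variable and only the
square remains to be controlled. -/
lemma exp_le_add_exp_sq (x : ℝ) : Real.exp x ≤ x + Real.exp (x ^ 2) := by
  have h2 := Real.add_one_le_exp (x ^ 2)
  rcases le_or_gt |x| 1 with h | h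
  · have := (abs_le.1 (Real.abs_exp_sub_one_sub_id_le h)).2
    linarith
  · rcases lt_abs.1 h with h | h
    · have : Real.exp x ≤ Real.exp (x ^ 2) := Real.exp_le_exp.2 (by nlinarith)
      linarith
    · have : Real.exp x ≤ 1 := Real.exp_le_one_iff.2 (by linarith)
      nlinarith

lemma exp_le_quadratic (x : ℝ) : Real.exp x ≤ 1 + x + x ^ 2 * Real.exp |x| := by
  have h := Complex.norm_exp_sub_sum_le_norm_mul_exp (x : ℂ) 2
  simp only [Finset.sum_range_succ, Finset.sum_range_zero] at h
  have e : Complex.exp x - (0 + (x : ℂ) ^ 0 / (Nat.factorial 0 : ℂ) + (x : ℂ) ^ 1 / (Nat.factorial 1 : ℂ))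
      = ((Real.exp x - 1 - x : ℝ) : ℂ) := by
    push_cast; simp; ring
  rw [e, Complex.norm_real, Complex.norm_real, Real.norm_eq_abs, Real.norm_eq_abs, sq_abs] at h
  linarith [(abs_le.1 h).2]

lemma exp_convex_le {θ y : ℝ} (h0 : 0 ≤ θ) (h1 : θ ≤ 1) :
    Real.exp (θ * y) ≤ 1 - θ + θ * Real.exp y := by
  have := convexOn_exp.2 (Set.mem_univ 0) (Set.mem_univ y) (sub_nonneg.2 h1) h0 (by ring)
  simpa using this

/-! ### From the ψ₂-norm to exponential moments of one variable. -/

section SingleVariable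

variable {ν : Measure ℝ} {K : ℝ}

lemma lintegral_even_moment_le (hK : 0 < K)
    (h : psiTwoNorm (fun x => x) ν ≤ ENNReal.ofReal K) (q : ℕ) (hq : 1 ≤ q) :
    ∫⁻ x, ENNReal.ofReal (x ^ (2 * q)) ∂ν ≤ ENNReal.ofReal (K ^ (2 * q) * (2 * q : ℝ) ^ q) := by
  have hq' : (1 : ℝ) ≤ q := by exact_mod_cast hq
  have ha : (1 : ℝ) ≤ 2 * q := by linarith
  have hpos : (0 : ℝ) < 2 * q := by linarith
  have h1 : ENNReal.ofReal ((2 * q : ℝ) ^ (-(1 / 2) : ℝ)) *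
      eLpNorm (fun x => x) (ENNReal.ofReal (2 * q)) ν ≤ ENNReal.ofReal K :=
    le_trans (le_iSup₂ (f := fun (a : ℝ) (_ : 1 ≤ a) => ENNReal.ofReal (a ^ (-(1 / 2) : ℝ)) *
      eLpNorm (fun x => x) (ENNReal.ofReal a) ν) _ ha) h
  rw [eLpNorm_eq_lintegral_rpow_enorm_toReal (by simp; omega) ENNReal.ofReal_ne_top,
    ENNReal.toReal_ofReal hpos.le] at h1
  have h2 := ENNReal.rpow_le_rpow h1 hpos.le
  rw [ENNReal.mul_rpow_of_nonneg _ _ hpos.le, ← ENNReal.rpow_mul,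
    one_div_mul_cancel hpos.ne', ENNReal.rpow_one,
    ENNReal.ofReal_rpow_of_nonneg (by positivity) hpos.le,
    ENNReal.ofReal_rpow_of_nonneg hK.le hpos.le, ← Real.rpow_mul hpos.le] at h2
  have e1 : (2 * q : ℝ) ^ (-(1 / 2) * (2 * q) : ℝ) = ((2 * q : ℝ) ^ q)⁻¹ := by
    rw [show (-(1 / 2) * (2 * q) : ℝ) = -(q : ℝ) by ring, Real.rpow_neg hpos.le, Real.rpow_natCast]
  have e2 : K ^ (2 * q : ℝ) = K ^ (2 * q) := by
    rw [← Real.rpow_natCast]; push_cast; rfl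
  rw [e1, e2] at h2
  have e3 : ∀ x : ℝ, ‖x‖ₑ ^ (2 * q : ℝ) = ENNReal.ofReal (x ^ (2 * q)) := by
    intro x
    rw [← ofReal_norm, ENNReal.ofReal_rpow_of_nonneg (norm_nonneg _) hpos.le,
      show (2 * q : ℝ) = ((2 * q : ℕ) : ℝ) by push_cast; rfl, Real.rpow_natCast,
      Real.norm_eq_abs, (even_two_mul q).pow_abs]
  simp_rw [e3] at h2
  have hc : (0 : ℝ) < (2 * q : ℝ) ^ q := by positivity
  calc ∫⁻ x, ENNReal.ofReal (x ^ (2 * q)) ∂ν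
      = ENNReal.ofReal ((2 * q : ℝ) ^ q) * (ENNReal.ofReal (((2 * q : ℝ) ^ q)⁻¹) *
        ∫⁻ x, ENNReal.ofReal (x ^ (2 * q)) ∂ν) := by
        rw [← mul_assoc, ← ENNReal.ofReal_mul hc.le, mul_inv_cancel₀ hc.ne']; simp
    _ ≤ ENNReal.ofReal ((2 * q : ℝ) ^ q) * ENNReal.ofReal (K ^ (2 * q)) := by gcongr
    _ = _ := by rw [← ENNReal.ofReal_mul hc.le, mul_comm]

/-- Expand the exponential. By the moment bound the term of order q is at most 2^{-q} · q^q / (q!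
e^q) ≤ 2^{-q}; the factor 4e is chosen for this geometric series. -/
lemma lintegral_exp_sq_le [IsProbabilityMeasure ν] (hK : 0 < K)
    (h : psiTwoNorm (fun x => x) ν ≤ ENNReal.ofReal K) :
    ∫⁻ x, expE ((4 * Real.exp 1 * K ^ 2)⁻¹ * x ^ 2) ∂ν ≤ 2 := by
  set l := (4 * Real.exp 1 * K ^ 2)⁻¹ with hl
  have hl0 : 0 < l := by positivity
  have e : ∀ x : ℝ, expE (l * x ^ 2) =
      ∑' q : ℕ, ENNReal.ofReal (l ^ q / q.factorial) * ENNReal.ofReal (x ^ (2 * q)) := by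
    intro x
    rw [expE, Real.exp_eq_exp_ℝ, NormedSpace.exp_eq_tsum_div,
      ENNReal.ofReal_tsum_of_nonneg (fun q => by positivity)
        (NormedSpace.expSeries_div_summable _)]
    refine tsum_congr fun q => ?_
    rw [← ENNReal.ofReal_mul (by positivity)]
    congr 1
    rw [mul_pow, ← pow_mul]; ring
  simp_rw [e]
  rw [lintegral_tsum fun q => by fun_prop]
  have key : ∀ q : ℕ, ∫⁻ x, ENNReal.ofReal (l ^ q / q.factorial) *
      ENNReal.ofReal (x ^ (2 * q)) ∂ν ≤ (2⁻¹ : ℝ≥0∞) ^ q := by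
    intro q
    rw [lintegral_const_mul _ (by fun_prop)]
    rcases Nat.eq_zero_or_pos q with rfl | hq
    · simp
    calc _ ≤ ENNReal.ofReal (l ^ q / q.factorial) *
          ENNReal.ofReal (K ^ (2 * q) * (2 * q : ℝ) ^ q) := by
          gcongr; exact lintegral_even_moment_le hK h q hq
      _ = ENNReal.ofReal (2⁻¹ ^ q * ((q : ℝ) ^ q / q.factorial * (Real.exp 1 ^ q)⁻¹)) := by
          rw [← ENNReal.ofReal_mul (by positivity)]
          congr 1
          rw [hl, inv_pow, mul_pow, mul_pow, mul_pow, pow_mul, inv_pow,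
            show (4 : ℝ) ^ q = 2 ^ q * 2 ^ q by rw [← mul_pow]; norm_num]
          field_simp
      _ ≤ ENNReal.ofReal (2⁻¹ ^ q) := by
          apply ENNReal.ofReal_le_ofReal
          apply mul_le_of_le_one_right (by positivity)
          rw [← div_eq_mul_inv, div_le_one (by positivity), ← Real.exp_nat_mul, mul_one]
          exact Real.pow_div_factorial_le_exp _ (by positivity) q
      _ = _ := by
          rw [ENNReal.ofReal_pow (by norm_num), ENNReal.ofReal_inv_of_pos (by norm_num)]; simp
  calc _ ≤ ∑' q : ℕ, (2⁻¹ : ℝ≥0∞) ^ q := ENNReal.tsum_le_tsum key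
    _ = 2 := by rw [ENNReal.tsum_geometric]; simp

/-- Two-sided control of a law on `ℝ`: a subgaussian bound for the variable and a sharp
subexponential bound for its square. -/
structure SubgaussianLaw (ν : Measure ℝ) (τ : ℝ) : Prop where
  lintegral_exp_mul_le : ∀ s : ℝ, ∫⁻ x, expE (s * x) ∂ν ≤ expE (τ * s ^ 2)
  lintegral_exp_sq_le : ∀ l : ℝ, 2 * τ * |l| ≤ 1 →
    ∫⁻ x, expE (l * x ^ 2) ∂ν ≤ ENNReal.ofReal (1 + l + 16 * τ ^ 2 * l ^ 2)

lemma lintegral_expE_le [IsProbabilityMeasure ν] {f g : ℝ → ℝ}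
    (hg : Integrable g ν) (h : ∀ x, Real.exp (f x) ≤ g x) :
    ∫⁻ x, expE (f x) ∂ν ≤ ENNReal.ofReal (∫ x, g x ∂ν) := by
  rw [ofReal_integral_eq_lintegral_ofReal hg (.of_forall fun x => (Real.exp_pos _).le.trans (h x))]
  exact lintegral_mono fun x => ENNReal.ofReal_le_ofReal (h x)

lemma integrable_affine_comb [IsProbabilityMeasure ν] {f g : ℝ → ℝ} (hf : Integrable f ν)
    (hg : Integrable g ν) (a b c : ℝ) : Integrable (fun x => a + b * f x + c * g x) ν :=
  ((integrable_const a).add (hf.const_mul b)).add (hg.const_mul c)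

lemma integral_affine_comb [IsProbabilityMeasure ν] {f g : ℝ → ℝ} (hf : Integrable f ν)
    (hg : Integrable g ν) (a b c : ℝ) :
    ∫ x, a + b * f x + c * g x ∂ν = a + b * ∫ x, f x ∂ν + c * ∫ x, g x ∂ν := by
  have h1 : Integrable (fun x => a + b * f x) ν := (integrable_const a).add (hf.const_mul b)
  rw [integral_add h1 (hg.const_mul c), integral_add (integrable_const a) (hf.const_mul b),
    integral_const_mul, integral_const_mul]
  simp

/-- Both bounds come from pointwise majorants by affine combinations of 1, x or x², and E =
exp(x²/τ), whose integral is at most 2. In the second, the coefficient of l is exactly the variance;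
this cancels the centering β in the Bernoulli mixture. -/
lemma subgaussianLaw_of_psiTwoNorm_le [IsProbabilityMeasure ν] (hK : 0 < K)
    (hmean : ∫ x, x ∂ν = 0) (hvar : ∫ x, x ^ 2 ∂ν = 1)
    (h : psiTwoNorm (fun x => x) ν ≤ ENNReal.ofReal K) :
    SubgaussianLaw ν (4 * Real.exp 1 * K ^ 2) := by
  have h2 := lintegral_exp_sq_le hK h
  set τ := 4 * Real.exp 1 * K ^ 2 with hτ
  have hτ0 : 0 < τ := by positivity
  set E : ℝ → ℝ := fun x => Real.exp (τ⁻¹ * x ^ 2) with hE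
  have hEi : Integrable E ν := by
    refine ⟨by fun_prop, ?_⟩
    rw [hasFiniteIntegral_iff_ofReal (.of_forall fun x => (Real.exp_pos _).le)]
    exact lt_of_le_of_lt h2 (by simp)
  have hE2 : ∫ x, E x ∂ν ≤ 2 := by
    rw [integral_eq_lintegral_of_nonneg_ae (.of_forall fun x => (Real.exp_pos _).le) (by fun_prop)]
    exact ENNReal.toReal_le_of_le_ofReal (by norm_num) (by simpa [expE] using h2)
  have hsq : Integrable (fun x : ℝ => x ^ 2) ν := by
    by_contra hc
    rw [integral_undef hc] at hvar; norm_num at hvar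
  have hid : Integrable (fun x : ℝ => x) ν := by
    refine Integrable.mono' ((integrable_const (1 : ℝ)).add hsq) (by fun_prop)
      (.of_forall fun x => ?_)
    simp only [Pi.add_apply, Real.norm_eq_abs]
    nlinarith [sq_abs x, sq_nonneg (|x| - 1)]
  refine ⟨fun s => ?_, fun l hl => ?_⟩
  · set θ := τ * s ^ 2 with hθ
    have hθ0 : 0 ≤ θ := by positivity
    rcases le_total θ 1 with h1 | h1
    -- For θ ≤ 1, convexity bounds exp((sx)²) = exp(θ · x²/τ) by 1 - θ + θE; integrating gives at
    -- most 1 + θ.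
    · refine (lintegral_expE_le (g := fun x => 1 - θ + s * x + θ * E x)
        (integrable_affine_comb hid hEi _ _ _) fun x => ?_).trans ?_
      · refine (exp_le_add_exp_sq _).trans ?_
        have := exp_convex_le (y := τ⁻¹ * x ^ 2) hθ0 h1
        have e : (s * x) ^ 2 = θ * (τ⁻¹ * x ^ 2) := by rw [hθ]; field_simp
        rw [e]; linarith
      · apply ENNReal.ofReal_le_ofReal
        rw [integral_affine_comb hid hEi, hmean]
        nlinarith [Real.add_one_le_exp θ]
    -- For θ ≥ 1, Young's inequality gives sx ≤ θ/2 + x²/(2τ), and the integrated majorant is at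
    -- most exp(θ/2) · 3/2 ≤ exp(θ).
    · refine (lintegral_expE_le (g := fun x => Real.exp (θ / 2) * (1 / 2 + 0 * x + 1 / 2 * E x))
        ((integrable_affine_comb hid hEi _ _ _).const_mul _) fun x => ?_).trans ?_
      · have := exp_convex_le (θ := 1 / 2) (y := τ⁻¹ * x ^ 2) (by norm_num) (by norm_num)
        have this : Real.exp (1 / 2 * (τ⁻¹ * x ^ 2)) ≤ 1 / 2 + 0 * x + 1 / 2 * E x := by linarith
        refine le_trans ?_ (mul_le_mul_of_nonneg_left this (Real.exp_pos _).le)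
        rw [← Real.exp_add]
        apply Real.exp_le_exp.2
        have e : θ / 2 + 1 / 2 * (τ⁻¹ * x ^ 2) - s * x = (τ * s - x) ^ 2 / (2 * τ) := by
          rw [hθ]; field_simp; ring
        have : 0 ≤ (τ * s - x) ^ 2 / (2 * τ) := by positivity
        linarith
      · apply ENNReal.ofReal_le_ofReal
        rw [integral_const_mul, integral_affine_comb hid hEi]
        have e : Real.exp θ = Real.exp (θ / 2) * Real.exp (θ / 2) := by
          rw [← Real.exp_add]; ring_nf
        rw [e]
        refine mul_le_mul_of_nonneg_left ?_ (Real.exp_pos _).le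
        linarith [Real.add_one_le_exp (θ / 2)]
  · have hl' : |l| ≤ τ⁻¹ / 2 := by
      rw [le_div_iff₀ (by norm_num), ← one_div, le_div_iff₀ hτ0]; linarith
    refine (lintegral_expE_le (g := fun x => 1 + l * x ^ 2 + 8 * τ ^ 2 * l ^ 2 * E x)
        (integrable_affine_comb hsq hEi _ _ _) fun x => ?_).trans ?_
    · refine (exp_le_quadratic _).trans ?_
      rw [abs_mul, abs_of_nonneg (sq_nonneg x)]
      -- With y = x²/(2τ), one factor exp(y) absorbs the exponential remainder and another absorbs
      -- y²/2; together they make up E.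
      set y := τ⁻¹ / 2 * x ^ 2 with hy
      have hy0 : 0 ≤ y := by positivity
      have a1 : Real.exp (|l| * x ^ 2) ≤ Real.exp y :=
        Real.exp_le_exp.2 (mul_le_mul_of_nonneg_right hl' (sq_nonneg x))
      have a2 : y ^ 2 / 2 ≤ Real.exp y := by
        simpa using Real.pow_div_factorial_le_exp y hy0 2
      have a3 : E x = Real.exp y * Real.exp y := by
        rw [← Real.exp_add, hE, hy]; ring_nf
      have a4 : x ^ 2 = 2 * τ * y := by rw [hy]; field_simp
      have : (l * x ^ 2) ^ 2 * Real.exp (|l| * x ^ 2) ≤ 8 * τ ^ 2 * l ^ 2 * E x := by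
        calc (l * x ^ 2) ^ 2 * Real.exp (|l| * x ^ 2) ≤ (l * x ^ 2) ^ 2 * Real.exp y := by gcongr
          _ = 8 * τ ^ 2 * l ^ 2 * ((y ^ 2 / 2) * Real.exp y) := by rw [a4]; ring
          _ ≤ 8 * τ ^ 2 * l ^ 2 * (Real.exp y * Real.exp y) := by gcongr
          _ = _ := by rw [a3]
      linarith
    · apply ENNReal.ofReal_le_ofReal
      rw [integral_affine_comb hsq hEi, hvar]
      have : 0 ≤ 8 * τ ^ 2 * l ^ 2 := by positivity
      nlinarith

end SingleVariable

/-! ### Exponential moments under product measures. -/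

section Product

variable {ι : Type*} [Fintype ι]

lemma lintegral_pi_prod {ν : ι → Measure ℝ} [∀ i, IsProbabilityMeasure (ν i)]
    {f : ι → ℝ → ℝ≥0∞} (hf : ∀ i, Measurable (f i)) :
    ∫⁻ x, ∏ i, f i (x i) ∂Measure.pi ν = ∏ i, ∫⁻ x, f i x ∂ν i := by
  refine (lintegral_prod_eq_prod_lintegral_of_indepFun Finset.univ
    (fun i (x : ι → ℝ) => f i (x i)) (iIndepFun_pi fun i => (hf i).aemeasurable)
    (fun i => (hf i).comp (measurable_pi_apply i))).trans ?_
  refine Finset.prod_congr rfl fun i _ => ?_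
  rw [← (measurePreserving_eval ν i).map_eq, lintegral_map (hf i) (measurable_pi_apply i)]

lemma lintegral_pi_expE_sum {ν : ι → Measure ℝ} [∀ i, IsProbabilityMeasure (ν i)]
    {f : ι → ℝ → ℝ} (hf : ∀ i, Measurable (f i)) :
    ∫⁻ x, expE (∑ i, f i (x i)) ∂Measure.pi ν = ∏ i, ∫⁻ x, expE (f i x) ∂ν i := by
  simp_rw [expE_sum]
  exact lintegral_pi_prod fun i => measurable_expE.comp (hf i)

lemma SubgaussianLaw.lintegral_pi_linear_le {ν : ι → Measure ℝ} [∀ i, IsProbabilityMeasure (ν i)]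
    {τ : ℝ} (hν : ∀ i, SubgaussianLaw (ν i) τ) (c : ι → ℝ) :
    ∫⁻ x, expE (∑ i, c i * x i) ∂Measure.pi ν ≤ expE (τ * ∑ i, c i ^ 2) := by
  rw [lintegral_pi_expE_sum (f := fun i t => c i * t) (fun i => by fun_prop), Finset.mul_sum,
    expE_sum]
  exact Finset.prod_le_prod' fun i _ => (hν i).lintegral_exp_mul_le _

end Product

/-! ### Gaussian exponential moments. -/

section Gaussian

lemma lintegral_gaussian_expE_mul (c : ℝ) :
    ∫⁻ z, expE (c * z) ∂gaussianReal 0 1 = expE (c ^ 2 / 2) := by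
  have h := mgf_gaussianReal (p := gaussianReal 0 1) (X := id) (μ := 0) (v := 1) (by simp) c
  unfold expE
  rw [← ofReal_integral_eq_lintegral_ofReal (integrable_exp_mul_gaussianReal c)
    (.of_forall fun x => (Real.exp_pos _).le)]
  simp only [mgf, id] at h
  rw [h]; simp

lemma lintegral_gaussian_expE_sq_le {a : ℝ} (h0 : 0 ≤ a) (h1 : 4 * a ≤ 1) :
    ∫⁻ z, expE (a * z ^ 2) ∂gaussianReal 0 1 ≤ expE (2 * a) := by
  rw [gaussianReal_of_var_ne_zero _ one_ne_zero,
    lintegral_withDensity_eq_lintegral_mul _ (by fun_prop) (by fun_prop)]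
  have hb : 0 < 1 / 2 - a := by linarith
  have e : ∀ z : ℝ, (gaussianPDF 0 1 * fun z => expE (a * z ^ 2)) z
      = ENNReal.ofReal ((√(2 * Real.pi))⁻¹ * Real.exp (-(1 / 2 - a) * z ^ 2)) := by
    intro z
    simp only [Pi.mul_apply, gaussianPDF, gaussianPDFReal, expE]
    rw [← ENNReal.ofReal_mul (by positivity), mul_assoc, ← Real.exp_add]
    simp only [NNReal.coe_one, mul_one, sub_zero]
    ring_nf
  simp_rw [e]
  rw [← ofReal_integral_eq_lintegral_ofReal ((integrable_exp_neg_mul_sq hb).const_mul _)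
    (.of_forall fun x => by positivity), integral_const_mul, integral_gaussian]
  apply ENNReal.ofReal_le_ofReal
  rw [← Real.sqrt_inv, ← Real.sqrt_mul (by positivity)]
  apply Real.sqrt_le_iff.2 ⟨(Real.exp_pos _).le, ?_⟩
  -- The exact value is (1 - 2a)^{-1/2}, and (1 - 2a)⁻¹ ≤ 1 + 4a precisely because 4a ≤ 1.
  rw [← Real.exp_nat_mul]
  have := Real.add_one_le_exp ((2 : ℕ) * (2 * a))
  refine le_trans ?_ this
  have e : (2 * Real.pi)⁻¹ * (Real.pi / (1 / 2 - a)) = 1 / (1 - 2 * a) := by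
    have : 1 - 2 * a ≠ 0 := by linarith
    have := Real.pi_pos.ne'
    field_simp
  rw [e, div_le_iff₀ (by linarith)]
  push_cast
  nlinarith

end Gaussian

/-! ### Positive semidefinite forms of subgaussian vectors. -/

section ChiSquare

variable {ι : Type*} [Fintype ι] [DecidableEq ι]

lemma Matrix.PosSemidef.exists_orthogonal_diagonalization {A : Matrix ι ι ℝ} (hA : A.PosSemidef)
    {L : ℝ} (hL : ∀ x : ι → ℝ, x ⬝ᵥ A *ᵥ x ≤ L * (x ⬝ᵥ x)) :
    ∃ (U : Matrix ι ι ℝ) (s : ι → ℝ), (∀ k, 0 ≤ s k) ∧ (∀ k, s k ≤ L) ∧ Uᵀ * U = 1 ∧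
      A = U * Matrix.diagonal s * Uᵀ ∧ ∑ k, s k = A.trace := by
  set U : Matrix ι ι ℝ := (hA.1.eigenvectorUnitary : Matrix ι ι ℝ)
  have hU : Uᵀ * U = 1 := by
    have := (Matrix.mem_unitaryGroup_iff' (A := U)).1 hA.1.eigenvectorUnitary.2
    simpa [Matrix.star_eq_conjTranspose] using this
  have hdec : A = U * Matrix.diagonal hA.1.eigenvalues * Uᵀ := by
    have := hA.1.spectral_theorem
    rw [Unitary.conjStarAlgAut_apply] at this
    simpa [Matrix.star_eq_conjTranspose, Function.comp_def] using this
  refine ⟨U, hA.1.eigenvalues, hA.eigenvalues_nonneg, fun k => ?_, hU, hdec, ?_⟩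
  · have h1 := hL (U *ᵥ Pi.single k 1)
    have e1 : (U *ᵥ Pi.single k 1) ⬝ᵥ (U *ᵥ Pi.single k 1) = 1 := by
      rw [Matrix.dotProduct_mulVec, ← Matrix.mulVec_transpose, Matrix.mulVec_mulVec, hU]; simp
    have e2 : (U *ᵥ Pi.single k 1) ⬝ᵥ A *ᵥ (U *ᵥ Pi.single k 1) = hA.1.eigenvalues k := by
      conv_lhs => rw [hdec]
      rw [Matrix.mulVec_mulVec, Matrix.mul_assoc, hU, Matrix.mul_one, ← Matrix.mulVec_mulVec,
        Matrix.dotProduct_mulVec, ← Matrix.mulVec_transpose, Matrix.mulVec_mulVec, hU]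
      simp
    rw [e1, e2, mul_one] at h1
    exact h1
  · have := hA.1.trace_eq_sum_eigenvalues
    simpa using this.symm

/-- Gaussian linearization: exp(c²/2) is the mean of exp(cZ). Applied along the eigenvectors of A it
makes the exponent linear in x, so x can be integrated first. What remains is a diagonal form in
independent Gaussians. -/
lemma SubgaussianLaw.lintegral_pi_quadratic_le {ν : ι → Measure ℝ}
    [∀ i, IsProbabilityMeasure (ν i)] {τ : ℝ} (hτ : 0 ≤ τ) (hν : ∀ i, SubgaussianLaw (ν i) τ)
    {A : Matrix ι ι ℝ} (hA : A.PosSemidef) {L m : ℝ} (hm : 0 ≤ m)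
    (hL : ∀ x : ι → ℝ, x ⬝ᵥ A *ᵥ x ≤ L * (x ⬝ᵥ x)) (hs : 8 * m * τ * L ≤ 1) :
    ∫⁻ x, expE (m * (x ⬝ᵥ A *ᵥ x)) ∂Measure.pi ν ≤ expE (4 * m * τ * A.trace) := by
  obtain ⟨U, s, hs0, hsL, hU, hdec, htr⟩ := hA.exists_orthogonal_diagonalization hL
  set γ : ι → Measure ℝ := fun _ => gaussianReal 0 1
  have e1 : ∀ x : ι → ℝ, expE (m * (x ⬝ᵥ A *ᵥ x)) =
      ∫⁻ z, expE (∑ i, (U *ᵥ fun k => √(2 * m * s k) * z k) i * x i) ∂Measure.pi γ := by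
    intro x
    have : ∀ z : ι → ℝ, ∑ i, (U *ᵥ fun k => √(2 * m * s k) * z k) i * x i =
        ∑ k, (√(2 * m * s k) * (Uᵀ *ᵥ x) k) * z k := by
      intro z
      change (U *ᵥ fun k => √(2 * m * s k) * z k) ⬝ᵥ x = _
      rw [dotProduct_comm, Matrix.dotProduct_mulVec, ← Matrix.mulVec_transpose]
      exact Finset.sum_congr rfl fun k _ => by ring
    simp_rw [this]
    rw [lintegral_pi_expE_sum (f := fun k t => (√(2 * m * s k) * (Uᵀ *ᵥ x) k) * t)
      (fun i => by fun_prop)]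
    simp_rw [γ, lintegral_gaussian_expE_mul]
    rw [← expE_sum]
    congr 1
    rw [hdec, ← Matrix.mulVec_mulVec, ← Matrix.mulVec_mulVec, Matrix.dotProduct_mulVec,
      ← Matrix.mulVec_transpose, dotProduct, Finset.mul_sum]
    refine Finset.sum_congr rfl fun k _ => ?_
    rw [mul_pow, Real.sq_sqrt (by have := hs0 k; positivity), Matrix.mulVec_diagonal]
    ring
  simp_rw [e1]
  rw [lintegral_lintegral_swap (by
    simp only [Matrix.mulVec, dotProduct, Function.uncurry_def]; fun_prop)]
  calc _ ≤ ∫⁻ z, expE (∑ k, (2 * m * τ * s k) * z k ^ 2) ∂Measure.pi γ := by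
        refine lintegral_mono fun z => (SubgaussianLaw.lintegral_pi_linear_le hν _).trans_eq ?_
        congr 1
        have : ∀ c : ι → ℝ, ∑ i, (U *ᵥ c) i ^ 2 = ∑ k, c k ^ 2 := by
          intro c
          have : (U *ᵥ c) ⬝ᵥ (U *ᵥ c) = c ⬝ᵥ c := by
            rw [Matrix.dotProduct_mulVec, ← Matrix.mulVec_transpose, Matrix.mulVec_mulVec, hU]
            simp
          simpa [dotProduct, sq] using this
        rw [this, Finset.mul_sum]
        refine Finset.sum_congr rfl fun k _ => ?_
        rw [mul_pow, Real.sq_sqrt (by have := hs0 k; positivity)]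
        ring
    _ = ∏ k, ∫⁻ z, expE ((2 * m * τ * s k) * z ^ 2) ∂gaussianReal 0 1 :=
        lintegral_pi_expE_sum (f := fun k t => (2 * m * τ * s k) * t ^ 2) (fun i => by fun_prop)
    _ ≤ ∏ k, expE (2 * (2 * m * τ * s k)) := by
        refine Finset.prod_le_prod' fun k _ => lintegral_gaussian_expE_sq_le ?_ ?_
        · have := hs0 k; positivity
        · have : m * τ * s k ≤ m * τ * L := mul_le_mul_of_nonneg_left (hsL k) (by positivity)
          linarith
    _ = _ := by
        rw [← expE_sum, ← htr, Finset.mul_sum]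
        congr 1
        exact Finset.sum_congr rfl fun k _ => by ring

end ChiSquare

/-! ### Bernoulli averages. -/

section Bernoulli

variable {β : unitInterval}

lemma lintegral_bernoulliMeasure {f : ℝ → ℝ≥0∞} (hf : Measurable f) :
    ∫⁻ x, f x ∂bernoulliMeasure (1 : ℝ) 0 β =
      ENNReal.ofReal β * f 1 + ENNReal.ofReal (1 - β) * f 0 := by
  rw [bernoulliMeasure_def, lintegral_add_measure, lintegral_smul_measure, lintegral_smul_measure,
    lintegral_dirac' _ hf, lintegral_dirac' _ hf]
  have h1 : ((unitInterval.toNNReal β : NNReal) : ℝ≥0∞) = ENNReal.ofReal β := by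
    rw [ENNReal.ofReal, Real.toNNReal_of_nonneg β.2.1]; rfl
  have h2 : ((unitInterval.toNNReal (unitInterval.symm β) : NNReal) : ℝ≥0∞) =
      ENNReal.ofReal (1 - β) := by
    rw [ENNReal.ofReal, Real.toNNReal_of_nonneg (sub_nonneg.2 β.2.2)]; rfl
  rw [← h1, ← h2]; rfl

lemma ae_bernoulliMeasure : ∀ᵐ x ∂bernoulliMeasure (1 : ℝ) 0 β, x = 1 ∨ x = 0 := by
  have hm : MeasurableSet {x : ℝ | x = 1 ∨ x = 0} :=
    (measurableSet_singleton (1 : ℝ)).union (measurableSet_singleton 0)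
  rw [bernoulliMeasure_def, ae_add_measure_iff]
  exact ⟨Measure.ae_smul_measure ((ae_dirac_iff hm).2 (Or.inl rfl)) _,
    Measure.ae_smul_measure ((ae_dirac_iff hm).2 (Or.inr rfl)) _⟩

lemma lintegral_bernoulli_expE_sq_le {a : ℝ} (h0 : 0 ≤ a) (h1 : a ≤ 1) :
    ∫⁻ x, expE (a * x ^ 2) ∂bernoulliMeasure (1 : ℝ) 0 β ≤ expE (2 * β * a) := by
  rw [lintegral_bernoulliMeasure (by fun_prop), expE, expE, ← ENNReal.ofReal_mul β.2.1,
    ← ENNReal.ofReal_mul (sub_nonneg.2 β.2.2), ← ENNReal.ofReal_add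
      (mul_nonneg β.2.1 (Real.exp_pos _).le)
      (mul_nonneg (sub_nonneg.2 β.2.2) (Real.exp_pos _).le)]
  apply ENNReal.ofReal_le_ofReal
  have h2 := (abs_le.1 (Real.abs_exp_sub_one_sub_id_le (x := a) (by rwa [abs_of_nonneg h0]))).2
  have h3 := Real.add_one_le_exp (2 * β * a)
  have h4 : (β : ℝ) * Real.exp a ≤ β * (1 + 2 * a) :=
    mul_le_mul_of_nonneg_left (by nlinarith) β.2.1
  norm_num
  linarith

/-- The mixture equals 1 when w = 0, so its mean is at most 1 + β(l + 16τ²l²) ≤ exp(βl + 16βτ²l²),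
and the centering removes βl. The surviving exponent keeps the factor β. -/
lemma SubgaussianLaw.lintegral_bernoulli_sq_centered_le {ν : Measure ℝ} [IsProbabilityMeasure ν]
    {τ l : ℝ}
    (hτ : 1 ≤ τ)
    (hν : SubgaussianLaw ν τ) (hl : 2 * τ * |l| ≤ 1) :
    ∫⁻ w, ∫⁻ x, expE (l * ((w * x) ^ 2 - β)) ∂ν ∂bernoulliMeasure (1 : ℝ) 0 β ≤
      expE (16 * β * τ ^ 2 * l ^ 2) := by
  have e : ∀ w : ℝ, ∫⁻ x, expE (l * ((w * x) ^ 2 - β)) ∂ν =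
      expE (-(l * β)) * ∫⁻ x, expE (l * w ^ 2 * x ^ 2) ∂ν := by
    intro w
    rw [← lintegral_const_mul _ (by fun_prop)]
    refine lintegral_congr fun x => ?_
    rw [← expE_add]; congr 1; ring
  have hm : Measurable fun w : ℝ => ∫⁻ x, expE (l * w ^ 2 * x ^ 2) ∂ν :=
    Measurable.lintegral_prod_right' (f := fun p : ℝ × ℝ => expE (l * p.1 ^ 2 * p.2 ^ 2))
      (by fun_prop)
  simp_rw [e]
  rw [lintegral_const_mul _ hm, lintegral_bernoulliMeasure hm]
  have h1 := hν.lintegral_exp_sq_le l hl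
  have hl2 : |l| ≤ 1 / 2 := by nlinarith [abs_nonneg l]
  have h0 : 0 ≤ 1 + l + 16 * τ ^ 2 * l ^ 2 := by
    have := neg_abs_le l
    have : 0 ≤ 16 * τ ^ 2 * l ^ 2 := by positivity
    linarith
  calc _ ≤ expE (-(l * β)) * (ENNReal.ofReal β * ENNReal.ofReal (1 + l + 16 * τ ^ 2 * l ^ 2) +
          ENNReal.ofReal (1 - β) * 1) := by
        gcongr
        · simpa using h1
        · simp [expE_zero]
    _ = ENNReal.ofReal (Real.exp (-(l * β)) * (1 + (l * β + 16 * β * τ ^ 2 * l ^ 2))) := by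
        rw [mul_one, ← ENNReal.ofReal_mul β.2.1, ← ENNReal.ofReal_add (mul_nonneg β.2.1 h0)
          (sub_nonneg.2 β.2.2), expE, ← ENNReal.ofReal_mul (Real.exp_pos _).le]
        congr 1; ring
    _ ≤ _ := by
        apply ENNReal.ofReal_le_ofReal
        have := Real.add_one_le_exp (l * β + 16 * β * τ ^ 2 * l ^ 2)
        calc _ ≤ Real.exp (-(l * β)) * Real.exp (l * β + 16 * β * τ ^ 2 * l ^ 2) := by
              gcongr; linarith
          _ = _ := by rw [← Real.exp_add]; ring_nf

end Bernoulli

/-! ### Decoupling by random subsets. -/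

section Decoupling

variable {ι : Type*} [Fintype ι] [DecidableEq ι]

lemma card_filter_mem_notMem {i j : ι} (h : i ≠ j) :
    4 * (Finset.univ.filter fun I : Finset ι => i ∈ I ∧ j ∉ I).card = 2 ^ Fintype.card ι := by
  have e : (Finset.univ.filter fun I : Finset ι => i ∈ I ∧ j ∉ I) = Finset.Icc {i} {j}ᶜ := by
    ext I
    simp only [Finset.mem_filter, Finset.mem_univ, true_and, Finset.mem_Icc,
      Finset.singleton_subset_iff, Finset.subset_compl_comm (s := I)]
    simp
  have hs : ({i} : Finset ι) ⊆ {j}ᶜ := by simpa using h.symm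
  rw [e, Finset.card_Icc_finset hs, Finset.card_compl, Finset.card_singleton,
    Finset.card_singleton]
  have : 2 ≤ Fintype.card ι := by
    have := Fintype.one_lt_card_iff.2 ⟨i, j, h⟩
    omega
  obtain ⟨n, hn⟩ := Nat.exists_eq_add_of_le this
  rw [hn, show 2 + n - 1 - 1 = n by omega, pow_add]
  norm_num

/-- The off-diagonal part of the quadratic form of `A`. -/
def offDiag (A : Matrix ι ι ℝ) (y : ι → ℝ) : ℝ :=
  ∑ i, ∑ j, if i = j then 0 else A i j * y i * y j

/-- The part of the quadratic form of `A` that couples `I` to its complement. -/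
def crossForm (A : Matrix ι ι ℝ) (I : Finset ι) (y : ι → ℝ) : ℝ :=
  ∑ i, ∑ j, if i ∈ I ∧ j ∉ I then A i j * y i * y j else 0

/-- Each ordered pair of distinct indices is separated, with i in I and j outside, by exactly a
quarter of the subsets I. -/
lemma sum_crossForm (A : Matrix ι ι ℝ) (y : ι → ℝ) :
    ∑ I : Finset ι, 4 * crossForm A I y = 2 ^ Fintype.card ι * offDiag A y := by
  simp only [crossForm, offDiag, Finset.mul_sum]
  rw [Finset.sum_comm]
  refine Finset.sum_congr rfl fun i _ => ?_
  rw [Finset.sum_comm]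
  refine Finset.sum_congr rfl fun j _ => ?_
  split_ifs with h
  · subst h; simp
  · rw [← Finset.mul_sum, ← Finset.sum_filter, Finset.sum_const, nsmul_eq_mul,
      ← mul_assoc]
    congr 1
    exact_mod_cast card_filter_mem_notMem h

lemma expE_offDiag_le (A : Matrix ι ι ℝ) (y : ι → ℝ) (l : ℝ) :
    expE (l * offDiag A y) ≤ (2 ^ Fintype.card ι)⁻¹ *
      ∑ I : Finset ι, expE (4 * l * crossForm A I y) := by
  have hc : (0 : ℝ) < 2 ^ Fintype.card ι := by positivity
  have h := convexOn_exp.map_sum_le (t := (Finset.univ : Finset (Finset ι)))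
    (w := fun _ => ((2 : ℝ) ^ Fintype.card ι)⁻¹) (p := fun I => 4 * l * crossForm A I y)
    (fun _ _ => by positivity) (by simp) (fun _ _ => Set.mem_univ _)
  have e : ∑ I : Finset ι, ((2 : ℝ) ^ Fintype.card ι)⁻¹ • (4 * l * crossForm A I y) =
      l * offDiag A y := by
    simp only [smul_eq_mul]
    rw [← Finset.mul_sum, inv_mul_eq_iff_eq_mul₀ hc.ne', mul_left_comm, ← sum_crossForm,
      Finset.mul_sum]
    exact Finset.sum_congr rfl fun I _ => by ring
  rw [e] at h
  refine (ENNReal.ofReal_le_ofReal h).trans_eq ?_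
  simp only [smul_eq_mul]
  rw [← Finset.mul_sum, ENNReal.ofReal_mul (by positivity),
    ENNReal.ofReal_sum_of_nonneg fun _ _ => (Real.exp_pos _).le, ENNReal.ofReal_inv_of_pos hc]
  simp [expE]

lemma dotProduct_mulVec_eq_diag_add_offDiag (A : Matrix ι ι ℝ) (y : ι → ℝ) :
    y ⬝ᵥ A *ᵥ y = ∑ i, A i i * y i ^ 2 + offDiag A y := by
  simp only [dotProduct, Matrix.mulVec, offDiag, Finset.mul_sum]
  rw [← Finset.sum_add_distrib]
  refine Finset.sum_congr rfl fun i _ => ?_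
  rw [← Finset.sum_erase_add _ _ (Finset.mem_univ i), add_comm]
  congr 1
  · ring
  · rw [← Finset.sum_erase_add _ (fun j => if i = j then 0 else A i j * y i * y j)
      (Finset.mem_univ i)]
    simp only [if_true, add_zero]
    refine Finset.sum_congr rfl fun j hj => ?_
    rw [if_neg (Finset.ne_of_mem_erase hj).symm]; ring

/-- Gluing two independent copies along I recovers the original law, so the coordinates inside and
outside I can be integrated separately. -/
lemma measurePreserving_piecewise {ν : ι → Measure ℝ} [∀ i, IsProbabilityMeasure (ν i)]
    (I : Finset ι) :
    MeasurePreserving (fun (p : (ι → ℝ) × (ι → ℝ)) i => if i ∈ I then p.1 i else p.2 i)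
      ((Measure.pi ν).prod (Measure.pi ν)) (Measure.pi ν) := by
  have hm : Measurable (fun (p : (ι → ℝ) × (ι → ℝ)) i => if i ∈ I then p.1 i else p.2 i) := by
    refine measurable_pi_lambda _ fun i => ?_
    split_ifs <;> fun_prop
  refine ⟨hm, (Measure.pi_eq fun s hs => ?_).symm⟩
  rw [Measure.map_apply hm (.univ_pi hs)]
  have e : (fun (p : (ι → ℝ) × (ι → ℝ)) i => if i ∈ I then p.1 i else p.2 i) ⁻¹' Set.univ.pi s =
      (Set.univ.pi fun i => if i ∈ I then s i else Set.univ) ×ˢ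
        (Set.univ.pi fun i => if i ∈ I then Set.univ else s i) := by
    ext p
    simp only [Set.mem_preimage, Set.mem_pi, Set.mem_univ, true_imp_iff, Set.mem_prod,
      ← forall_and]
    refine forall_congr' fun i => ?_
    split_ifs <;> simp
  rw [e, Measure.prod_prod, Measure.pi_pi, Measure.pi_pi, ← Finset.prod_mul_distrib]
  refine Finset.prod_congr rfl fun i _ => ?_
  split_ifs <;> simp

end Decoupling

/-! ### The sparse Hanson-Wright inequality. -/

section HansonWright

variable {ι : Type*} [Fintype ι] [DecidableEq ι] {A : Matrix ι ι ℝ} {L : ℝ}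

/-- This is A² ≤ LA, read off from s² ≤ Ls for the eigenvalues. On basis vectors it gives ‖Ae_j‖² ≤
L A_jj, the source of L tr A in the exponents. -/
lemma Matrix.PosSemidef.mulVec_dotProduct_mulVec_le (hA : A.PosSemidef)
    (hL : ∀ x : ι → ℝ, x ⬝ᵥ A *ᵥ x ≤ L * (x ⬝ᵥ x)) (x : ι → ℝ) :
    (A *ᵥ x) ⬝ᵥ (A *ᵥ x) ≤ L * (x ⬝ᵥ A *ᵥ x) := by
  obtain ⟨U, s, hs0, hsL, hU, hdec, -⟩ := hA.exists_orthogonal_diagonalization hL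
  have e1 : (A *ᵥ x) ⬝ᵥ (A *ᵥ x) = ∑ k, s k ^ 2 * (Uᵀ *ᵥ x) k ^ 2 := by
    rw [hdec, ← Matrix.mulVec_mulVec, ← Matrix.mulVec_mulVec, Matrix.dotProduct_mulVec,
      ← Matrix.mulVec_transpose, Matrix.mulVec_mulVec, hU, Matrix.one_mulVec, dotProduct]
    refine Finset.sum_congr rfl fun k _ => ?_
    rw [Matrix.mulVec_diagonal]; ring
  have e2 : x ⬝ᵥ A *ᵥ x = ∑ k, s k * (Uᵀ *ᵥ x) k ^ 2 := by
    rw [hdec, ← Matrix.mulVec_mulVec, ← Matrix.mulVec_mulVec, Matrix.dotProduct_mulVec,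
      ← Matrix.mulVec_transpose, dotProduct]
    refine Finset.sum_congr rfl fun k _ => ?_
    rw [Matrix.mulVec_diagonal]; ring
  rw [e1, e2, Finset.mul_sum]
  refine Finset.sum_le_sum fun k _ => ?_
  rw [← mul_assoc, sq (s k)]
  have := hs0 k
  gcongr
  exact hsL k

lemma Matrix.diag_le_of_quadratic_le (hL : ∀ x : ι → ℝ, x ⬝ᵥ A *ᵥ x ≤ L * (x ⬝ᵥ x)) (i : ι) :
    A i i ≤ L := by
  simpa using hL (Pi.single i 1)

variable {ν : ι → Measure ℝ} [∀ i, IsProbabilityMeasure (ν i)] {τ l : ℝ} {β : unitInterval}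

/-- For fixed z outside I the form is linear in the entries inside I; integrating these leaves a
multiple of ‖ADz‖², where D carries the weights outside I. The bound for quadratic forms then
applies with (AD)ᵀ(AD) ≤ L², and the trace is computed column by column. -/
lemma SubgaussianLaw.lintegral_crossForm_le (hτ : 0 ≤ τ) (hν : ∀ i, SubgaussianLaw (ν i) τ)
    (hA : A.PosSemidef) (hL0 : 0 ≤ L) (hL : ∀ x : ι → ℝ, x ⬝ᵥ A *ᵥ x ≤ L * (x ⬝ᵥ x))
    (hl : 128 * τ ^ 2 * l ^ 2 * L ^ 2 ≤ 1) (I : Finset ι) {w : ι → ℝ} (hw : ∀ i, w i ^ 2 ≤ 1) :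
    ∫⁻ g, expE (4 * l * crossForm A I fun i => w i * g i) ∂Measure.pi ν ≤
      expE (∑ j, 64 * τ ^ 2 * l ^ 2 * L * A j j * w j ^ 2) := by
  set D : Matrix ι ι ℝ := Matrix.diagonal fun j => if j ∈ I then 0 else w j with hD
  have hDle : ∀ x : ι → ℝ, (D *ᵥ x) ⬝ᵥ (D *ᵥ x) ≤ x ⬝ᵥ x := by
    intro x
    refine Finset.sum_le_sum fun i _ => ?_
    rw [hD, Matrix.mulVec_diagonal]
    split_ifs
    · simpa using mul_self_nonneg (x i)
    · nlinarith [hw i, mul_self_nonneg (x i), mul_le_mul_of_nonneg_right (hw i) (sq_nonneg (x i))]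
  have hq : ∀ x : ι → ℝ, x ⬝ᵥ ((A * D)ᵀ * (A * D)) *ᵥ x = (A *ᵥ (D *ᵥ x)) ⬝ᵥ (A *ᵥ (D *ᵥ x)) := by
    intro x
    rw [← Matrix.mulVec_mulVec, Matrix.dotProduct_mulVec, ← Matrix.mulVec_transpose,
      Matrix.transpose_transpose, Matrix.mulVec_mulVec]
  have hmp := measurePreserving_piecewise (ν := ν) I
  have hmeas : Measurable fun g : ι → ℝ => expE (4 * l * crossForm A I fun i => w i * g i) := by
    unfold crossForm
    refine measurable_expE.comp (Measurable.const_mul (Finset.measurable_sum _ fun i _ =>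
      Finset.measurable_sum _ fun j _ => ?_) _)
    split_ifs <;> fun_prop
  rw [← hmp.lintegral_comp hmeas]
  refine (lintegral_prod_symm _ (hmeas.comp hmp.measurable).aemeasurable).trans_le ?_
  calc _ ≤ ∫⁻ z, expE (16 * τ * l ^ 2 * (z ⬝ᵥ ((A * D)ᵀ * (A * D)) *ᵥ z)) ∂Measure.pi ν := by
        refine lintegral_mono fun z => ?_
        have e : ∀ g : ι → ℝ, 4 * l * crossForm A I (fun i => w i * if i ∈ I then g i else z i) =
            ∑ i, (4 * l * (if i ∈ I then w i else 0) * (A *ᵥ (D *ᵥ z)) i) * g i := by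
          intro g
          rw [crossForm, Finset.mul_sum]
          refine Finset.sum_congr rfl fun i _ => ?_
          by_cases hi : i ∈ I
          · simp only [hi, true_and, if_true, Matrix.mulVec, dotProduct, hD]
            simp only [Finset.mul_sum, Finset.sum_mul]
            refine Finset.sum_congr rfl fun j _ => ?_
            by_cases hj : j ∈ I
            · simp [hj, Matrix.diagonal_apply]
            · simp [hj, Matrix.diagonal_apply]; ring
          · simp [hi]
        change ∫⁻ g, expE (4 * l * crossForm A I
          (fun i => w i * if i ∈ I then g i else z i)) ∂Measure.pi ν ≤ _
        simp only [e]
        refine (SubgaussianLaw.lintegral_pi_linear_le hν _).trans (expE_le_expE ?_)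
        rw [hq, dotProduct, mul_comm 16 τ, mul_assoc, mul_assoc]
        refine mul_le_mul_of_nonneg_left ?_ hτ
        rw [Finset.mul_sum, Finset.mul_sum]
        refine Finset.sum_le_sum fun i _ => ?_
        have h1 : (if i ∈ I then w i else 0) ^ 2 ≤ 1 := by
          split_ifs
          · exact hw i
          · norm_num
        have h2 : 0 ≤ l ^ 2 * (A *ᵥ (D *ᵥ z)) i ^ 2 := by positivity
        nlinarith [mul_le_mul_of_nonneg_left h1 h2]
    _ ≤ expE (4 * (16 * τ * l ^ 2) * τ * ((A * D)ᵀ * (A * D)).trace) := by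
        refine SubgaussianLaw.lintegral_pi_quadratic_le hτ hν (L := L ^ 2) ?_ (by positivity) ?_ ?_
        · simpa using Matrix.posSemidef_conjTranspose_mul_self (A * D)
        · intro x
          rw [hq, sq, mul_assoc]
          refine (hA.mulVec_dotProduct_mulVec_le hL _).trans ?_
          gcongr
          exact (hL _).trans (by gcongr; exact hDle x)
        · linarith
    _ ≤ _ := by
        apply expE_le_expE
        rw [Matrix.trace, Finset.mul_sum]
        refine Finset.sum_le_sum fun j _ => ?_
        have e1 : ((A * D)ᵀ * (A * D)).diag j =
            (if j ∈ I then 0 else w j) ^ 2 * ((A *ᵥ Pi.single j 1) ⬝ᵥ (A *ᵥ Pi.single j 1)) := by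
          have hAD : ∀ i, (A * D) i j = A i j * if j ∈ I then 0 else w j := by simp [hD]
          rw [Matrix.diag_apply, Matrix.mul_apply]
          simp only [Matrix.transpose_apply, hAD, dotProduct, Matrix.mulVec_single_one,
            Matrix.col_apply, Finset.mul_sum]
          exact Finset.sum_congr rfl fun i _ => by ring
        have e2 := hA.mulVec_dotProduct_mulVec_le hL (Pi.single j 1)
        have e3 : (Pi.single j 1 : ι → ℝ) ⬝ᵥ A *ᵥ Pi.single j 1 = A j j := by simp
        rw [e3] at e2
        have e4 : (if j ∈ I then 0 else w j) ^ 2 ≤ w j ^ 2 := by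
          split_ifs
          · simpa using sq_nonneg (w j)
          · rfl
        have e5 : ((A * D)ᵀ * (A * D)).diag j ≤ w j ^ 2 * (L * A j j) := by
          rw [e1]
          refine mul_le_mul e4 e2 ?_ (sq_nonneg _)
          exact Finset.sum_nonneg fun i _ => mul_self_nonneg _
        have := mul_le_mul_of_nonneg_left e5 (by positivity : 0 ≤ 4 * (16 * τ * l ^ 2) * τ)
        linarith

omit [DecidableEq ι] in
lemma ae_pi_bernoulliMeasure : ∀ᵐ w ∂Measure.pi (fun _ : ι => bernoulliMeasure (1 : ℝ) 0 β),
    ∀ i, w i = 1 ∨ w i = 0 :=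
  ae_all_iff.2 fun i => (measurePreserving_eval (fun _ : ι => bernoulliMeasure (1 : ℝ) 0 β)
    i).quasiMeasurePreserving.ae ae_bernoulliMeasure

lemma measurable_offDiag : Measurable (offDiag A) := by
  unfold offDiag
  refine Finset.measurable_sum _ fun i _ => Finset.measurable_sum _ fun j _ => ?_
  split_ifs <;> fun_prop

lemma measurable_crossForm (I : Finset ι) : Measurable (crossForm A I) := by
  unfold crossForm
  refine Finset.measurable_sum _ fun i _ => Finset.measurable_sum _ fun j _ => ?_
  split_ifs <;> fun_prop

lemma SubgaussianLaw.lintegral_offDiag_le (hτ : 0 ≤ τ) (hν : ∀ i, SubgaussianLaw (ν i) τ)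
    (hA : A.PosSemidef) (hL0 : 0 ≤ L) (hL : ∀ x : ι → ℝ, x ⬝ᵥ A *ᵥ x ≤ L * (x ⬝ᵥ x))
    (hl : 128 * τ ^ 2 * l ^ 2 * L ^ 2 ≤ 1) :
    ∫⁻ w, ∫⁻ g, expE (l * offDiag A fun i => w i * g i) ∂Measure.pi ν
        ∂Measure.pi (fun _ : ι => bernoulliMeasure (1 : ℝ) 0 β) ≤
      expE (128 * β * τ ^ 2 * l ^ 2 * (L * A.trace)) := by
  have hdiag : ∀ i, 0 ≤ A i i := fun i => hA.diag_nonneg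
  calc _ ≤ ∫⁻ w, expE (∑ j, 64 * τ ^ 2 * l ^ 2 * L * A j j * w j ^ 2)
        ∂Measure.pi (fun _ : ι => bernoulliMeasure (1 : ℝ) 0 β) := by
        refine lintegral_mono_ae ?_
        filter_upwards [ae_pi_bernoulliMeasure (ι := ι) (β := β)] with w hw
        have hw1 : ∀ i, w i ^ 2 ≤ 1 := fun i => by rcases hw i with h | h <;> simp [h]
        have hcross (I : Finset ι) :
            Measurable fun g : ι → ℝ => expE (4 * l * crossForm A I fun i => w i * g i) :=
          measurable_expE.comp (((measurable_crossForm I).comp (by fun_prop)).const_mul _)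
        calc _ ≤ ∫⁻ g, (2 ^ Fintype.card ι)⁻¹ *
              ∑ I : Finset ι, expE (4 * l * crossForm A I fun i => w i * g i) ∂Measure.pi ν :=
              lintegral_mono fun g => expE_offDiag_le _ _ _
          _ = (2 ^ Fintype.card ι)⁻¹ * ∑ I : Finset ι,
              ∫⁻ g, expE (4 * l * crossForm A I fun i => w i * g i) ∂Measure.pi ν := by
              rw [lintegral_const_mul _ (Finset.measurable_sum _ fun I _ => hcross I),
                lintegral_finsetSum _ fun I _ => hcross I]
          _ ≤ (2 ^ Fintype.card ι)⁻¹ * ∑ I : Finset ι,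
              expE (∑ j, 64 * τ ^ 2 * l ^ 2 * L * A j j * w j ^ 2) := by
              gcongr with I
              exact SubgaussianLaw.lintegral_crossForm_le hτ hν hA hL0 hL hl I hw1
          _ = _ := by
              rw [Finset.sum_const, Finset.card_univ, Fintype.card_finset, nsmul_eq_mul,
                ← mul_assoc]
              push_cast
              rw [ENNReal.inv_mul_cancel (by simp) (by simp), one_mul]
    _ = ∏ j, ∫⁻ t, expE (64 * τ ^ 2 * l ^ 2 * L * A j j * t ^ 2)
        ∂bernoulliMeasure (1 : ℝ) 0 β :=
        lintegral_pi_expE_sum (f := fun j t => 64 * τ ^ 2 * l ^ 2 * L * A j j * t ^ 2)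
          (fun _ => by fun_prop)
    _ ≤ ∏ j, expE (2 * β * (64 * τ ^ 2 * l ^ 2 * L * A j j)) := by
        refine Finset.prod_le_prod' fun j _ => lintegral_bernoulli_expE_sq_le ?_ ?_
        · have := hdiag j; positivity
        · have h1 := Matrix.diag_le_of_quadratic_le hL j
          have h2 : 64 * τ ^ 2 * l ^ 2 * L * A j j ≤ 64 * τ ^ 2 * l ^ 2 * L * L := by gcongr
          have h3 : 0 ≤ 64 * τ ^ 2 * l ^ 2 * L * L := by positivity
          linarith
    _ = _ := by
        rw [← expE_sum, Matrix.trace, Finset.mul_sum, Finset.mul_sum]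
        congr 1
        exact Finset.sum_congr rfl fun j _ => by rw [Matrix.diag_apply]; ring

lemma SubgaussianLaw.lintegral_diag_le (hτ : 1 ≤ τ) (hν : ∀ i, SubgaussianLaw (ν i) τ)
    (hA : A.PosSemidef) (hL : ∀ x : ι → ℝ, x ⬝ᵥ A *ᵥ x ≤ L * (x ⬝ᵥ x))
    (hl : 2 * τ * |l| * L ≤ 1) :
    ∫⁻ w, ∫⁻ g, expE (∑ i, l * A i i * ((w i * g i) ^ 2 - β)) ∂Measure.pi ν
        ∂Measure.pi (fun _ : ι => bernoulliMeasure (1 : ℝ) 0 β) ≤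
      expE (16 * β * τ ^ 2 * l ^ 2 * (L * A.trace)) := by
  have hdiag : ∀ i, 0 ≤ A i i := fun i => hA.diag_nonneg
  have e : ∀ w : ι → ℝ, ∫⁻ g, expE (∑ i, l * A i i * ((w i * g i) ^ 2 - β)) ∂Measure.pi ν =
      ∏ i, ∫⁻ x, expE (l * A i i * ((w i * x) ^ 2 - β)) ∂ν i := fun w =>
    lintegral_pi_expE_sum (f := fun i t => l * A i i * ((w i * t) ^ 2 - β)) (fun _ => by fun_prop)
  simp_rw [e]
  rw [lintegral_pi_prod (f := fun i t => ∫⁻ x, expE (l * A i i * ((t * x) ^ 2 - β)) ∂ν i)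
    (fun i => Measurable.lintegral_prod_right'
      (f := fun p : ℝ × ℝ => expE (l * A i i * ((p.1 * p.2) ^ 2 - β))) (by fun_prop))]
  calc _ ≤ ∏ i, expE (16 * β * τ ^ 2 * (l * A i i) ^ 2) := by
        refine Finset.prod_le_prod' fun i _ =>
          SubgaussianLaw.lintegral_bernoulli_sq_centered_le hτ (hν i) ?_
        rw [abs_mul, abs_of_nonneg (hdiag i), ← mul_assoc]
        refine le_trans ?_ hl
        gcongr
        exact Matrix.diag_le_of_quadratic_le hL i
    _ ≤ _ := by
        rw [← expE_sum, Matrix.trace, Finset.mul_sum, Finset.mul_sum]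
        refine expE_le_expE (Finset.sum_le_sum fun i _ => ?_)
        have h1 : A i i * A i i ≤ L * A i i :=
          mul_le_mul_of_nonneg_right (Matrix.diag_le_of_quadratic_le hL i) (hdiag i)
        have h2 : 0 ≤ 16 * β * τ ^ 2 * l ^ 2 := by have := β.2.1; positivity
        rw [Matrix.diag_apply]
        linarith [mul_le_mul_of_nonneg_left h1 h2]

lemma expE_add_le (x y : ℝ) : expE (x + y) ≤ 2⁻¹ * (expE (2 * x) + expE (2 * y)) := by
  have h : Real.exp (x + y) ≤ 2⁻¹ * (Real.exp (2 * x) + Real.exp (2 * y)) := by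
    rw [two_mul, two_mul, Real.exp_add, Real.exp_add, Real.exp_add]
    nlinarith [sq_nonneg (Real.exp x - Real.exp y)]
  refine (ENNReal.ofReal_le_ofReal h).trans_eq ?_
  rw [ENNReal.ofReal_mul (by norm_num), ENNReal.ofReal_add (Real.exp_pos _).le (Real.exp_pos _).le,
    ENNReal.ofReal_inv_of_pos (by norm_num)]
  simp [expE]

/-- Moment generating function form of the sparse Hanson-Wright inequality. -/
theorem SubgaussianLaw.lintegral_sparse_quadratic_le (hτ : 1 ≤ τ)
    (hν : ∀ i, SubgaussianLaw (ν i) τ) (hA : A.PosSemidef) (hL0 : 0 ≤ L)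
    (hL : ∀ x : ι → ℝ, x ⬝ᵥ A *ᵥ x ≤ L * (x ⬝ᵥ x)) (hl : 512 * τ ^ 2 * l ^ 2 * L ^ 2 ≤ 1) :
    ∫⁻ w, ∫⁻ g, expE (l * ((fun i => w i * g i) ⬝ᵥ A *ᵥ (fun i => w i * g i) - β * A.trace))
        ∂Measure.pi ν ∂Measure.pi (fun _ : ι => bernoulliMeasure (1 : ℝ) 0 β) ≤
      expE (512 * β * τ ^ 2 * l ^ 2 * (L * A.trace)) := by
  have e : ∀ w g : ι → ℝ,
      expE (l * ((fun i => w i * g i) ⬝ᵥ A *ᵥ (fun i => w i * g i) - β * A.trace)) ≤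
      2⁻¹ * (expE (∑ i, (2 * l) * A i i * ((w i * g i) ^ 2 - β)) +
        expE ((2 * l) * offDiag A fun i => w i * g i)) := by
    intro w g
    convert expE_add_le (∑ i, l * A i i * ((w i * g i) ^ 2 - β))
      (l * offDiag A fun i => w i * g i) using 3
    · rw [dotProduct_mulVec_eq_diag_add_offDiag]
      have : ∑ i, l * A i i * ((w i * g i) ^ 2 - β) =
          l * (∑ i, A i i * (w i * g i) ^ 2 - β * A.trace) := by
        rw [Matrix.trace, Finset.mul_sum, ← Finset.sum_sub_distrib, Finset.mul_sum]
        exact Finset.sum_congr rfl fun i _ => by rw [Matrix.diag_apply]; ring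
      rw [this]; ring
    · rw [Finset.mul_sum]
      exact congrArg expE (Finset.sum_congr rfl fun i _ => by ring)
    · rw [mul_assoc]
  have hm1 : Measurable fun p : (ι → ℝ) × (ι → ℝ) =>
      expE (∑ i, (2 * l) * A i i * ((p.1 i * p.2 i) ^ 2 - β)) := by fun_prop
  have hm2 : Measurable fun p : (ι → ℝ) × (ι → ℝ) =>
      expE ((2 * l) * offDiag A fun i => p.1 i * p.2 i) :=
    measurable_expE.comp ((measurable_offDiag.comp (by fun_prop)).const_mul _)
  have htr : 0 ≤ L * A.trace := mul_nonneg hL0 hA.trace_nonneg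
  have h1 : 2 * τ * |2 * l| * L ≤ 1 := by
    have hl4 : (2 * τ * |2 * l| * L) ^ 2 ≤ 1 := by
      rw [mul_pow, mul_pow, sq_abs]
      have : 0 ≤ τ ^ 2 * l ^ 2 * L ^ 2 := by positivity
      nlinarith
    nlinarith
  have hd := SubgaussianLaw.lintegral_diag_le (β := β) hτ hν hA hL h1
  have ho := SubgaussianLaw.lintegral_offDiag_le (β := β) (l := 2 * l) (by linarith) hν hA hL0 hL
    (by linarith)
  calc _ ≤ ∫⁻ w, ∫⁻ g, 2⁻¹ * (expE (∑ i, (2 * l) * A i i * ((w i * g i) ^ 2 - β)) +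
        expE ((2 * l) * offDiag A fun i => w i * g i))
        ∂Measure.pi ν ∂Measure.pi (fun _ : ι => bernoulliMeasure (1 : ℝ) 0 β) :=
        lintegral_mono fun w => lintegral_mono fun g => e w g
    _ = 2⁻¹ * (∫⁻ w, ∫⁻ g, expE (∑ i, (2 * l) * A i i * ((w i * g i) ^ 2 - β)) ∂Measure.pi ν
          ∂Measure.pi (fun _ : ι => bernoulliMeasure (1 : ℝ) 0 β) +
        ∫⁻ w, ∫⁻ g, expE ((2 * l) * offDiag A fun i => w i * g i) ∂Measure.pi ν
          ∂Measure.pi (fun _ : ι => bernoulliMeasure (1 : ℝ) 0 β)) := by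
        have hM1 : Measurable fun w : ι → ℝ =>
            ∫⁻ g, expE (∑ i, (2 * l) * A i i * ((w i * g i) ^ 2 - β)) ∂Measure.pi ν :=
          hm1.lintegral_prod_right'
        have hM2 : Measurable fun w : ι → ℝ =>
            ∫⁻ g, expE ((2 * l) * offDiag A fun i => w i * g i) ∂Measure.pi ν :=
          hm2.lintegral_prod_right'
        rw [← lintegral_add_left hM1]
        refine Eq.trans (lintegral_congr fun w => ?_) (lintegral_const_mul _ (hM1.add hM2))
        have := hm1.comp (measurable_prodMk_left (x := w))
        have h2 := hm2.comp (measurable_prodMk_left (x := w))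
        exact (lintegral_const_mul _ (this.add h2)).trans
          (congrArg _ (lintegral_add_left this _))
    _ ≤ 2⁻¹ * (expE (512 * β * τ ^ 2 * l ^ 2 * (L * A.trace)) +
          expE (512 * β * τ ^ 2 * l ^ 2 * (L * A.trace))) := by
        have : 0 ≤ β * τ ^ 2 * l ^ 2 * (L * A.trace) := by have := β.2.1; positivity
        gcongr
        · exact hd.trans (expE_le_expE (by nlinarith))
        · exact ho.trans (expE_le_expE (by nlinarith))
    _ = _ := by
        rw [← two_mul, ← mul_assoc, ENNReal.inv_mul_cancel (by simp) (by simp), one_mul]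

lemma measure_le_of_lintegral_expE_le {Ω : Type*} [MeasurableSpace Ω] {P : Measure Ω} {f : Ω → ℝ}
    (hf : Measurable f) {a b : ℝ} (h : ∫⁻ x, expE (f x) ∂P ≤ expE b) :
    P {x | a ≤ f x} ≤ expE (b - a) := by
  have h1 : expE a * P {x | a ≤ f x} ≤ expE b := by
    refine le_trans ?_ ((mul_meas_ge_le_lintegral (measurable_expE.comp hf) (expE a)).trans h)
    gcongr with x hx
    exact expE_le_expE
  calc P {x | a ≤ f x} = expE (-a) * (expE a * P {x | a ≤ f x}) := by
        rw [← mul_assoc, ← expE_add, neg_add_cancel, expE_zero, one_mul]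
    _ ≤ expE (-a) * expE b := by gcongr
    _ = _ := by rw [← expE_add]; congr 1; ring

/-- Tail form of the sparse Hanson-Wright inequality. -/
theorem SubgaussianLaw.measure_sparse_quadratic_le (hτ : 1 ≤ τ)
    (hν : ∀ i, SubgaussianLaw (ν i) τ) (hA : A.PosSemidef) (hL0 : 0 < L)
    (hL : ∀ x : ι → ℝ, x ⬝ᵥ A *ᵥ x ≤ L * (x ⬝ᵥ x)) {t : ℝ} (ht0 : 0 ≤ t) (ht1 : t ≤ 1) :
    ((Measure.pi fun _ : ι => bernoulliMeasure (1 : ℝ) 0 β).prod (Measure.pi ν))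
      {p | t * (β * A.trace) ≤
        |(fun i => p.1 i * p.2 i) ⬝ᵥ A *ᵥ (fun i => p.1 i * p.2 i) - β * A.trace|} ≤
      2 * expE (-(t ^ 2 * β * A.trace / (2048 * τ ^ 2 * L))) := by
  set P := (Measure.pi fun _ : ι => bernoulliMeasure (1 : ℝ) 0 β).prod (Measure.pi ν)
  set Q : (ι → ℝ) × (ι → ℝ) → ℝ := fun p =>
    (fun i => p.1 i * p.2 i) ⬝ᵥ A *ᵥ (fun i => p.1 i * p.2 i) - β * A.trace with hQ
  have hQm : Measurable Q := by
    simp only [hQ, Matrix.mulVec, dotProduct]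
    fun_prop
  set l := t / (1024 * τ ^ 2 * L) with hl
  have hτ0 : 0 < τ := by linarith
  have hl0 : 0 ≤ l := by positivity
  have hcond : 512 * τ ^ 2 * l ^ 2 * L ^ 2 ≤ 1 := by
    have e : 512 * τ ^ 2 * l ^ 2 * L ^ 2 = t ^ 2 / (2048 * τ ^ 2) := by
      rw [hl]; field_simp; ring
    rw [e, div_le_one (by positivity)]
    nlinarith
  have hB : 512 * β * τ ^ 2 * l ^ 2 * (L * A.trace) - l * (t * (β * A.trace)) =
      -(t ^ 2 * β * A.trace / (2048 * τ ^ 2 * L)) := by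
    rw [hl]; field_simp; ring
  have hmgf : ∀ σ : ℝ, σ ^ 2 = 1 → ∫⁻ p, expE (σ * l * Q p) ∂P ≤
      expE (512 * β * τ ^ 2 * l ^ 2 * (L * A.trace)) := by
    intro σ hσ
    refine (lintegral_prod _ (measurable_expE.comp (hQm.const_mul _)).aemeasurable).trans_le ?_
    refine (SubgaussianLaw.lintegral_sparse_quadratic_le (l := σ * l) hτ hν hA hL0.le hL
      (by rw [mul_pow, hσ, one_mul]; exact hcond)).trans_eq ?_
    rw [mul_pow, hσ, one_mul]
  have hbound : ∀ σ : ℝ, σ ^ 2 = 1 → P {p | t * (β * A.trace) ≤ σ * Q p} ≤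
      expE (-(t ^ 2 * β * A.trace / (2048 * τ ^ 2 * L))) := by
    intro σ hσ
    rw [← hB]
    refine le_trans (measure_mono fun p hp => ?_)
      (measure_le_of_lintegral_expE_le (hQm.const_mul (σ * l)) (hmgf σ hσ))
    simp only [Set.mem_ofPred_eq] at hp ⊢
    calc _ ≤ l * (σ * Q p) := mul_le_mul_of_nonneg_left hp hl0
      _ = _ := by ring
  calc _ ≤ P ({p | t * (β * A.trace) ≤ 1 * Q p} ∪ {p | t * (β * A.trace) ≤ -1 * Q p}) := by
        refine measure_mono fun p hp => ?_
        rcases le_abs.1 (show t * (β * A.trace) ≤ |Q p| from hp) with h | h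
        · left; simpa using h
        · right; simpa using h
    _ ≤ _ := (measure_union_le _ _).trans
        ((add_le_add (hbound 1 (by norm_num)) (hbound (-1) (by norm_num))).trans_eq (two_mul _).symm)

end HansonWright

section Net

variable {E F : Type*} [NormedAddCommGroup E] [InnerProductSpace ℝ E] [FiniteDimensional ℝ E]
  [NormedAddCommGroup F] [InnerProductSpace ℝ F]

lemma exists_half_net_sphere (E : Type*) [NormedAddCommGroup E] [InnerProductSpace ℝ E]
    [FiniteDimensional ℝ E] :
    ∃ N : Finset E, N.card ≤ 5 ^ Module.finrank ℝ E ∧ (∀ y ∈ N, ‖y‖ = 1) ∧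
      ∀ x : E, ‖x‖ = 1 → ∃ y ∈ N, ‖x - y‖ ≤ 1 / 2 := by
  classical
  set V : Set ℕ := {m | ∃ s : Finset E, s.card = m ∧ (∀ y ∈ s, ‖y‖ = 1) ∧
    ∀ x ∈ s, ∀ y ∈ s, x ≠ y → 1 / 2 ≤ ‖x - y‖} with hV
  have hcard : ∀ s : Finset E, (∀ y ∈ s, ‖y‖ = 1) →
      (∀ x ∈ s, ∀ y ∈ s, x ≠ y → 1 / 2 ≤ ‖x - y‖) → s.card ≤ 5 ^ Module.finrank ℝ E := by
    intro s h1 h2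
    have hinj : Function.Injective fun x : E => (2 : ℝ) • x :=
      smul_right_injective E two_ne_zero
    rw [← Finset.card_image_of_injective s hinj]
    refine Besicovitch.card_le_of_separated _ ?_ ?_
    · simp only [Finset.mem_image, forall_exists_index, and_imp, forall_apply_eq_imp_iff₂]
      intro x hx
      rw [norm_smul, h1 x hx]; norm_num
    · simp only [Finset.mem_image, forall_exists_index, and_imp, forall_apply_eq_imp_iff₂]
      intro x hx y hy hxy
      rw [← smul_sub, norm_smul]
      have := h2 x hx y hy (fun h => hxy (by rw [h]))
      norm_num; linarith
  have hne : V.Nonempty := ⟨0, ∅, by simp⟩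
  have hbdd : BddAbove V := ⟨5 ^ Module.finrank ℝ E, by
    rintro m ⟨s, rfl, h1, h2⟩
    exact hcard s h1 h2⟩
  obtain ⟨s, hs, h1, h2⟩ := Nat.sSup_mem hne hbdd
  refine ⟨s, hcard s h1 h2, h1, fun x hx => ?_⟩
  by_contra! hc
  have hxs : x ∉ s := fun h => by have := hc x h; norm_num at this
  have hmem : (insert x s).card ∈ V := by
    refine ⟨insert x s, rfl, ?_, ?_⟩
    · simpa [hx] using h1
    · intro a ha b hb hab
      rcases Finset.mem_insert.1 ha with ha' | ha' <;> rcases Finset.mem_insert.1 hb with hb' | hb'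
      · exact absurd (ha'.trans hb'.symm) hab
      · rw [ha']; exact (hc b hb').le
      · rw [hb', norm_sub_rev]; exact (hc a ha').le
      · exact h2 a ha' b hb' hab
  have := le_csSup hbdd hmem
  rw [Finset.card_insert_of_notMem hxs, hs] at this
  omega

lemma norm_sq_deviation_le_of_net {N : Finset E} (hN1 : ∀ y ∈ N, ‖y‖ = 1)
    (hN : ∀ x : E, ‖x‖ = 1 → ∃ y ∈ N, ‖x - y‖ ≤ 1 / 2) (Y : E →ₗ[ℝ] F) {c t : ℝ}
    (h : ∀ y ∈ N, |‖Y y‖ ^ 2 - c| ≤ t) {x : E} (hx : ‖x‖ = 1) : |‖Y x‖ ^ 2 - c| ≤ 32 * t := by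
  set q : E → ℝ := fun v => ‖Y v‖ ^ 2 - c * ‖v‖ ^ 2 with hq
  have hqc : Continuous q := by
    have := Y.continuous_of_finiteDimensional
    fun_prop
  have hq1 : ∀ v : E, ‖v‖ = 1 → ‖Y v‖ ^ 2 - c = q v := fun v hv => by simp [hq, hv]
  obtain ⟨z, hz, hmax⟩ := (isCompact_sphere (0 : E) 1).exists_isMaxOn ⟨x, by simpa using hx⟩
    (f := fun v => |q v|) hqc.abs.continuousOn
  have hz1 : ‖z‖ = 1 := by simpa using hz
  set m := |q z| with hm
  have hle : ∀ v : E, |q v| ≤ m * ‖v‖ ^ 2 := by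
    intro v
    rcases eq_or_ne v 0 with rfl | hv
    · simp [hq]
    have hv' : ‖v‖ ≠ 0 := norm_ne_zero_iff.2 hv
    have h1 : |q (‖v‖⁻¹ • v)| ≤ m := hmax (by simp [norm_smul, hv'])
    have h2 : q v = ‖v‖ ^ 2 * q (‖v‖⁻¹ • v) := by
      simp only [hq, map_smul, norm_smul, norm_inv, norm_norm]
      field_simp
    rw [h2, abs_mul, abs_of_nonneg (sq_nonneg _), mul_comm]
    gcongr
  obtain ⟨y, hy, hzy⟩ := hN z hz1
  have hy1 := hN1 y hy
  have hin : 7 / 8 ≤ inner ℝ z y := by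
    have h1 := norm_sub_sq_real z y
    have h2 : ‖z - y‖ ^ 2 ≤ (1 / 2) ^ 2 := by gcongr
    rw [hz1, hy1] at h1
    linarith
  have hexp (p r : E) (a b : ℝ) : ‖a • p - b • r‖ ^ 2 =
      a ^ 2 * ‖p‖ ^ 2 - 2 * a * b * inner ℝ p r + b ^ 2 * ‖r‖ ^ 2 := by
    rw [norm_sub_sq_real, norm_smul, norm_smul, real_inner_smul_left, real_inner_smul_right,
      mul_pow, mul_pow, Real.norm_eq_abs, Real.norm_eq_abs, sq_abs, sq_abs]
    ring
  have hexpY (p r : E) (a b : ℝ) : ‖Y (a • p - b • r)‖ ^ 2 =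
      a ^ 2 * ‖Y p‖ ^ 2 - 2 * a * b * inner ℝ (Y p) (Y r) + b ^ 2 * ‖Y r‖ ^ 2 := by
    rw [map_sub, map_smul, map_smul, norm_sub_sq_real, norm_smul, norm_smul, real_inner_smul_left,
      real_inner_smul_right, mul_pow, mul_pow, Real.norm_eq_abs, Real.norm_eq_abs, sq_abs, sq_abs]
    ring
  have hid : 4 * (q z - q y) =
      q ((5 / 2 : ℝ) • z - (3 / 2 : ℝ) • y) - q ((5 / 2 : ℝ) • y - (3 / 2 : ℝ) • z) := by
    simp only [hq, hexp, hexpY, real_inner_comm y z, real_inner_comm (Y y) (Y z)]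
    ring
  have b1 := hle ((5 / 2 : ℝ) • z - (3 / 2 : ℝ) • y)
  have b2 := hle ((5 / 2 : ℝ) • y - (3 / 2 : ℝ) • z)
  rw [hexp, hz1, hy1] at b1
  rw [hexp, hz1, hy1, real_inner_comm] at b2
  have b3 : |q y| ≤ t := by rw [← hq1 y hy1]; exact h y hy
  have hm0 : 0 ≤ m := abs_nonneg _
  have b4 : |4 * (q z - q y)| ≤ m * (17 - 15 * inner ℝ z y) := by
    rw [hid]
    refine (abs_sub _ _).trans ?_
    linarith
  have b5 : m ≤ |q y| + |q z - q y| := by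
    rw [hm]; calc |q z| = |q y + (q z - q y)| := by ring_nf
      _ ≤ _ := abs_add_le _ _
  rw [abs_mul, abs_of_pos (by norm_num : (0 : ℝ) < 4)] at b4
  have b6 : m * (7 / 8) ≤ m * inner ℝ z y := by gcongr
  rw [hq1 x hx]
  have := hle x
  rw [hx] at this
  linarith

end Net

section SparseNet

/-- Extension by zero of a vector indexed by a finite set of coordinates. -/
noncomputable def extendZero {d : ℕ} (T : Finset (Fin d)) :
    EuclideanSpace ℝ T →ₗ[ℝ] EuclideanSpace ℝ (Fin d) where
  toFun x := WithLp.toLp 2 fun j => if h : j ∈ T then x ⟨j, h⟩ else 0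
  map_add' x y := by ext j; by_cases h : j ∈ T <;> simp [h]
  map_smul' a x := by ext j; by_cases h : j ∈ T <;> simp [h]

lemma norm_extendZero {d : ℕ} (T : Finset (Fin d)) (x : EuclideanSpace ℝ T) :
    ‖extendZero T x‖ = ‖x‖ := by
  rw [EuclideanSpace.norm_eq, EuclideanSpace.norm_eq]
  congr 1
  rw [← Finset.sum_subset (Finset.subset_univ T) fun j _ hj => by simp [extendZero, hj],
    ← Finset.sum_coe_sort]
  exact Finset.sum_congr rfl fun j _ => by simp [extendZero]

lemma exists_extendZero_eq {d : ℕ} {T : Finset (Fin d)} {u : EuclideanSpace ℝ (Fin d)}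
    (hu : ∀ j, u j ≠ 0 → j ∈ T) : ∃ x, extendZero T x = u := by
  refine ⟨WithLp.toLp 2 fun j => u j, ?_⟩
  ext j
  by_cases h : j ∈ T
  · simp [extendZero, h]
  · simp [extendZero, h, not_not.1 (mt (hu j) h)]

lemma choose_mul_five_pow_le {d k : ℕ} (hk : 1 ≤ k) :
    ((d.choose (min k d) * 5 ^ min k d : ℕ) : ℝ) ≤
      Real.exp (4 * (k * max 1 (Real.log (d / k)))) := by
  have hk0 : (0 : ℝ) < k := by exact_mod_cast hk
  have h5 : (5 : ℝ) ≤ Real.exp 2 := by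
    have h1 := Real.exp_one_gt_d9
    have h2 : Real.exp 2 = Real.exp 1 * Real.exp 1 := by rw [← Real.exp_add]; norm_num
    rw [h2]; nlinarith
  have h5k : (5 : ℝ) ^ k ≤ Real.exp (2 * k) := by
    rw [mul_comm, Real.exp_nat_mul]; gcongr
  have hl1 : (k : ℝ) ≤ k * max 1 (Real.log (d / k)) :=
    le_mul_of_one_le_right hk0.le (le_max_left _ _)
  rcases le_total d k with h | h
  · rw [min_eq_right h, Nat.choose_self, one_mul]
    push_cast
    calc (5 : ℝ) ^ d ≤ 5 ^ k := pow_le_pow_right₀ (by norm_num) h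
      _ ≤ _ := h5k
      _ ≤ _ := Real.exp_le_exp.2 (by linarith)
  · rw [min_eq_left h]
    push_cast
    have hd0 : (0 : ℝ) < d := hk0.trans_le (by exact_mod_cast h)
    have hl2 : k * Real.log (d / k) ≤ k * max 1 (Real.log (d / k)) := by
      gcongr; exact le_max_right _ _
    have hch : (d.choose k : ℝ) ≤ Real.exp (k * Real.log (d / k) + k) := by
      calc (d.choose k : ℝ) ≤ (d : ℝ) ^ k / k.factorial := Nat.choose_le_pow_div k d
        _ = (d / k : ℝ) ^ k * ((k : ℝ) ^ k / k.factorial) := by rw [div_pow]; field_simp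
        _ ≤ (d / k : ℝ) ^ k * Real.exp k := by
          gcongr; exact Real.pow_div_factorial_le_exp _ hk0.le k
        _ = _ := by rw [Real.exp_add, Real.exp_nat_mul, Real.exp_log (by positivity)]
    calc (d.choose k : ℝ) * 5 ^ k ≤ Real.exp (k * Real.log (d / k) + k) * Real.exp (2 * k) := by
          gcongr
      _ = Real.exp (k * Real.log (d / k) + k + 2 * k) := by rw [← Real.exp_add]
      _ ≤ _ := Real.exp_le_exp.2 (by linarith)

lemma exists_sparse_net (d k : ℕ) (hk : 1 ≤ k) :
    ∃ N : Finset (EuclideanSpace ℝ (Fin d)), (∀ y ∈ N, ‖y‖ = 1) ∧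
      (N.card : ℝ) ≤ Real.exp (4 * (k * max 1 (Real.log (d / k)))) ∧
      ∀ {n : ℕ} (Y : EuclideanSpace ℝ (Fin d) →ₗ[ℝ] EuclideanSpace ℝ (Fin n)) (c t : ℝ),
        (∀ y ∈ N, |‖Y y‖ ^ 2 - c| ≤ t) → ∀ u ∈ sparseSphere d k, |‖Y u‖ ^ 2 - c| ≤ 32 * t := by
  classical
  choose net hcard hnorm hnet using fun T : Finset (Fin d) =>
    exists_half_net_sphere (EuclideanSpace ℝ T)
  refine ⟨(Finset.univ.powersetCard (min k d)).biUnion fun T => (net T).image (extendZero T),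
    ?_, ?_, ?_⟩
  · simp only [Finset.mem_biUnion, Finset.mem_image]
    rintro _ ⟨T, -, y, hy, rfl⟩
    rw [norm_extendZero, hnorm T y hy]
  · refine le_trans ?_ (choose_mul_five_pow_le hk)
    rw [Nat.cast_le]
    refine (Finset.card_biUnion_le_card_mul _ _ (5 ^ min k d) fun T hT => ?_).trans_eq ?_
    · refine Finset.card_image_le.trans ((hcard T).trans_eq ?_)
      rw [finrank_euclideanSpace, Fintype.card_coe, (Finset.mem_powersetCard.1 hT).2]
    · rw [Finset.card_powersetCard, Finset.card_univ, Fintype.card_fin]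
  · intro n Y c t h u hu
    set Su : Finset (Fin d) := Finset.univ.filter fun j => u j ≠ 0 with hSu
    have h1 : Su.card ≤ min k d := by
      refine le_min ?_ ((Finset.card_le_univ _).trans_eq (Fintype.card_fin d))
      have := hu.2
      rwa [Set.ncard_eq_toFinset_card', Set.toFinset_ofPred] at this
    obtain ⟨T, hST, hT⟩ := Finset.exists_superset_card_eq h1
      ((min_le_right k d).trans_eq (Fintype.card_fin d).symm)
    obtain ⟨x, rfl⟩ := exists_extendZero_eq (T := T) (u := u) fun j hj =>
      hST (by simp [hSu, hj])
    refine norm_sq_deviation_le_of_net (hnorm T) (hnet T) (Y ∘ₗ extendZero T) (fun y hy => ?_) ?_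
    · refine h _ (Finset.mem_biUnion.2 ⟨T, ?_, Finset.mem_image_of_mem _ hy⟩)
      exact Finset.mem_powersetCard.2 ⟨Finset.subset_univ _, hT⟩
    · rw [← norm_extendZero]; exact hu.1

end SparseNet

section RankOne

variable {n p d : ℕ} (X : Matrix (Fin n) (Fin p) ℝ) (y : Fin d → ℝ)

/-- The matrix of the linear map `Z ↦ X Z y`. -/
def applyMatrix : Matrix (Fin n) (Fin p × Fin d) ℝ :=
  Matrix.of fun r e => X r e.1 * y e.2

lemma applyMatrix_mulVec (Z : Matrix (Fin p) (Fin d) ℝ) :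
    applyMatrix X y *ᵥ (fun e => Z e.1 e.2) = X *ᵥ (Z *ᵥ y) := by
  ext r
  simp only [applyMatrix, Matrix.mulVec, dotProduct, Matrix.of_apply, Fintype.sum_prod_type,
    Finset.mul_sum]
  exact Finset.sum_congr rfl fun i _ => Finset.sum_congr rfl fun j _ => by ring

lemma dotProduct_gram_mulVec {m ι : Type*} [Fintype m] [Fintype ι] (M : Matrix m ι ℝ)
    (z : ι → ℝ) : z ⬝ᵥ (Mᵀ * M) *ᵥ z = (M *ᵥ z) ⬝ᵥ (M *ᵥ z) := by
  rw [← Matrix.mulVec_mulVec, Matrix.dotProduct_mulVec, ← Matrix.mulVec_transpose,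
    Matrix.transpose_transpose]

lemma frobNorm_sq : frobNorm X ^ 2 = ∑ i, ∑ j, X i j ^ 2 :=
  Real.sq_sqrt (Finset.sum_nonneg fun _ _ => Finset.sum_nonneg fun _ _ => sq_nonneg _)

lemma trace_gram_applyMatrix (hy : y ⬝ᵥ y = 1) :
    ((applyMatrix X y)ᵀ * applyMatrix X y).trace = frobNorm X ^ 2 := by
  rw [frobNorm_sq, Finset.sum_comm]
  simp only [Matrix.trace, Matrix.diag_apply, Matrix.mul_apply, Matrix.transpose_apply,
    applyMatrix, Matrix.of_apply, Fintype.sum_prod_type]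
  refine Finset.sum_congr rfl fun i _ => ?_
  rw [Finset.sum_comm]
  refine Finset.sum_congr rfl fun r _ => ?_
  calc _ = X r i ^ 2 * (y ⬝ᵥ y) := by
        rw [dotProduct, Finset.mul_sum]
        exact Finset.sum_congr rfl fun j _ => by ring
    _ = _ := by rw [hy, mul_one]

lemma mulVec_dotProduct_mulVec_le_specNorm (v : Fin p → ℝ) :
    (X *ᵥ v) ⬝ᵥ (X *ᵥ v) ≤ specNorm X ^ 2 * (v ⬝ᵥ v) := by
  have h := Matrix.l2_opNorm_mulVec X (WithLp.toLp 2 v)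
  have h2 := pow_le_pow_left₀ (norm_nonneg _) h 2
  rw [mul_pow, EuclideanSpace.real_norm_sq_eq, EuclideanSpace.real_norm_sq_eq] at h2
  simpa [dotProduct, sq, specNorm] using h2

open scoped Matrix.Norms.L2Operator in
lemma specNorm_nonneg : 0 ≤ specNorm X := norm_nonneg X

lemma gram_applyMatrix_le (hy : y ⬝ᵥ y = 1) (z : Fin p × Fin d → ℝ) :
    z ⬝ᵥ ((applyMatrix X y)ᵀ * applyMatrix X y) *ᵥ z ≤ specNorm X ^ 2 * (z ⬝ᵥ z) := by
  rw [dotProduct_gram_mulVec]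
  have e := applyMatrix_mulVec X y (Matrix.of fun i j => z (i, j))
  simp only [Matrix.of_apply, Prod.mk.eta] at e
  rw [e]
  refine (mulVec_dotProduct_mulVec_le_specNorm X _).trans ?_
  gcongr
  simp only [dotProduct, Fintype.sum_prod_type]
  refine Finset.sum_le_sum fun i _ => ?_
  have h := Finset.sum_mul_sq_le_sq_mul_sq Finset.univ (fun j => z (i, j)) y
  have hy' : ∑ j, y j ^ 2 = 1 := by simpa [dotProduct, sq] using hy
  rw [hy', mul_one] at h
  simpa [Matrix.mulVec, dotProduct, sq] using h

end RankOne

section Model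

variable {S : Type*} [MeasurableSpace S] {μ : Measure S} [IsProbabilityMeasure μ] {n p d : ℕ}
  {W G : S → Matrix (Fin p) (Fin d) ℝ} {β : unitInterval} {K : ℝ}

omit [IsProbabilityMeasure μ] in
lemma psiTwoNorm_map {x : S → ℝ} (hx : Measurable x) :
    psiTwoNorm (fun t => t) (μ.map x) = psiTwoNorm x μ := by
  unfold psiTwoNorm
  congr! 5
  rw [eLpNorm_map_measure (by fun_prop) hx.aemeasurable]
  rfl

lemma IsBernoulliSubgaussian.map_prod (h : IsBernoulliSubgaussian μ W G β K) :
    μ.map (fun s => ((fun e : Fin p × Fin d => W s e.1 e.2),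
        (fun e : Fin p × Fin d => G s e.1 e.2))) =
      (Measure.pi fun _ => bernoulliMeasure (1 : ℝ) 0 β).prod
        (Measure.pi fun e => μ.map fun s => G s e.1 e.2) := by
  have hW : ∀ e : Fin p × Fin d, Measurable fun s => W s e.1 e.2 := fun e => h.measurable_W _ _
  have hG : ∀ e : Fin p × Fin d, Measurable fun s => G s e.1 e.2 := fun e => h.measurable_G _ _
  rw [(indepFun_iff_map_prod_eq_prod_map_map (measurable_pi_lambda _ hW).aemeasurable
      (measurable_pi_lambda _ hG).aemeasurable).1 h.indep_W_G,
    (iIndepFun_iff_map_fun_eq_pi_map fun e => (hW e).aemeasurable).1 h.indep_W,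
    (iIndepFun_iff_map_fun_eq_pi_map fun e => (hG e).aemeasurable).1 h.indep_G]
  congr 2
  ext1 e
  exact (h.law_W e.1 e.2).map_eq

lemma IsBernoulliSubgaussian.subgaussianLaw (h : IsBernoulliSubgaussian μ W G β K) (hK : 0 < K)
    (e : Fin p × Fin d) :
    SubgaussianLaw (μ.map fun s => G s e.1 e.2) (4 * Real.exp 1 * K ^ 2) := by
  have hG := h.measurable_G e.1 e.2
  have : IsProbabilityMeasure (μ.map fun s => G s e.1 e.2) :=
    Measure.isProbabilityMeasure_map hG.aemeasurable
  refine subgaussianLaw_of_psiTwoNorm_le hK ?_ ?_ ?_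
  · rw [integral_map hG.aemeasurable (by fun_prop)]; exact h.mean_G _ _
  · rw [integral_map hG.aemeasurable (by fun_prop)]; exact h.var_G _ _
  · rw [psiTwoNorm_map hG]; exact h.psiTwo_G _ _

omit [IsProbabilityMeasure μ] in
lemma IsBernoulliSubgaussian.one_le_two_mul_sq (h : IsBernoulliSubgaussian μ W G β K) (hK : 0 < K)
    (e : Fin p × Fin d) : 1 ≤ 2 * K ^ 2 := by
  have hG := h.measurable_G e.1 e.2
  have h1 := lintegral_even_moment_le hK ((psiTwoNorm_map hG).trans_le (h.psiTwo_G e.1 e.2)) 1 le_rfl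
  rw [lintegral_map (by fun_prop) hG] at h1
  have hv := h.var_G e.1 e.2
  have hint : Integrable (fun s => G s e.1 e.2 ^ 2) μ := by
    by_contra hc
    rw [integral_undef hc] at hv
    norm_num at hv
  simp only [mul_one, Nat.cast_one, pow_one] at h1
  rw [← ofReal_integral_eq_lintegral_ofReal hint (.of_forall fun s => sq_nonneg _), hv,
    ENNReal.ofReal_le_ofReal_iff (by positivity)] at h1
  linarith

/-- Concentration of `‖X R y‖²` around `‖X‖_F²` for a fixed unit vector `y`. -/
lemma IsBernoulliSubgaussian.measure_deviation_le (h : IsBernoulliSubgaussian μ W G β K)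
    (hK : 0 < K) (hβ : 0 < (β : ℝ)) {X : Matrix (Fin n) (Fin p) ℝ} (hX : 0 < specNorm X)
    (hp : Nonempty (Fin p × Fin d)) {y : EuclideanSpace ℝ (Fin d)} (hy : ‖y‖ = 1) {t : ℝ}
    (ht0 : 0 ≤ t) (ht1 : t ≤ 1) :
    μ {s | t * frobNorm X ^ 2 < |‖Matrix.toEuclideanLin
        (X * (((1 : ℝ) * Real.sqrt β)⁻¹ • (W s ⊙ G s))) y‖ ^ 2 - frobNorm X ^ 2|} ≤
      2 * expE (-(t ^ 2 * β * stableRank X / (2048 * 16 * Real.exp 1 ^ 2 * K ^ 4))) := by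
  have hy' : (y : Fin d → ℝ) ⬝ᵥ (y : Fin d → ℝ) = 1 := by
    have := EuclideanSpace.real_norm_sq_eq y
    rw [hy, one_pow] at this
    simpa [dotProduct, sq] using this.symm
  set M := applyMatrix X (y : Fin d → ℝ) with hM
  have hτ : 1 ≤ 4 * Real.exp 1 * K ^ 2 := by
    have h1 := h.one_le_two_mul_sq hK hp.some
    have h2 := Real.add_one_le_exp (1 : ℝ)
    nlinarith
  have hlaw := h.subgaussianLaw hK
  have (e : Fin p × Fin d) : IsProbabilityMeasure (μ.map fun s => G s e.1 e.2) :=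
    Measure.isProbabilityMeasure_map (h.measurable_G e.1 e.2).aemeasurable
  have hA : (Mᵀ * M).PosSemidef := by
    simpa using Matrix.posSemidef_conjTranspose_mul_self M
  have key := SubgaussianLaw.measure_sparse_quadratic_le (β := β) hτ hlaw hA
    (pow_pos hX 2) (gram_applyMatrix_le X _ hy') ht0 ht1
  rw [← h.map_prod] at key
  have hmeas : AEMeasurable (fun s => ((fun e : Fin p × Fin d => W s e.1 e.2),
        (fun e : Fin p × Fin d => G s e.1 e.2))) μ :=
    ((measurable_pi_lambda _ fun e => h.measurable_W _ _).prodMk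
      (measurable_pi_lambda _ fun e => h.measurable_G _ _)).aemeasurable
  have key2 := (Measure.le_map_apply hmeas _).trans key
  rw [trace_gram_applyMatrix X _ hy'] at key2
  have hexp : t ^ 2 * β * frobNorm X ^ 2 / (2048 * (4 * Real.exp 1 * K ^ 2) ^ 2 * specNorm X ^ 2) =
      t ^ 2 * β * stableRank X / (2048 * 16 * Real.exp 1 ^ 2 * K ^ 4) := by
    rw [stableRank]
    field_simp
    ring
  rw [hexp] at key2
  refine le_trans (measure_mono fun s hs => ?_) key2
  simp only [Set.mem_preimage, Set.mem_ofPred_eq] at hs ⊢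
  rw [dotProduct_gram_mulVec]
  have e1 : M *ᵥ (fun e : Fin p × Fin d => W s e.1 e.2 * G s e.1 e.2) =
      X *ᵥ ((W s ⊙ G s) *ᵥ (y : Fin d → ℝ)) := applyMatrix_mulVec X y (W s ⊙ G s)
  rw [e1]
  have e2 : ‖Matrix.toEuclideanLin (X * (((1 : ℝ) * Real.sqrt β)⁻¹ • (W s ⊙ G s))) y‖ ^ 2 =
      (β : ℝ)⁻¹ * ((X *ᵥ ((W s ⊙ G s) *ᵥ (y : Fin d → ℝ))) ⬝ᵥ
        (X *ᵥ ((W s ⊙ G s) *ᵥ (y : Fin d → ℝ)))) := by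
    rw [Matrix.mul_smul, map_smul, LinearMap.smul_apply, norm_smul, mul_pow, one_mul, norm_inv,
      inv_pow, Real.norm_eq_abs, sq_abs, Real.sq_sqrt hβ.le, EuclideanSpace.real_norm_sq_eq,
      Matrix.mulVec_mulVec]
    simp [dotProduct, sq, Matrix.toLpLin_apply]
  rw [e2] at hs
  set Q := (X *ᵥ ((W s ⊙ G s) *ᵥ (y : Fin d → ℝ))) ⬝ᵥ (X *ᵥ ((W s ⊙ G s) *ᵥ (y : Fin d → ℝ)))
  have e3 : |Q - β * frobNorm X ^ 2| = β * |(β : ℝ)⁻¹ * Q - frobNorm X ^ 2| := by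
    rw [← abs_of_pos hβ, ← abs_mul, abs_of_pos hβ]
    congr 1
    field_simp
  rw [e3]
  nlinarith

end Model

lemma productRIP_of_abs_le {n p d k : ℕ} {X : Matrix (Fin n) (Fin p) ℝ}
    {R : Matrix (Fin p) (Fin d) ℝ} {ε : ℝ} (hε0 : 0 ≤ ε) (hε1 : ε ≤ 1)
    (h : ∀ u ∈ sparseSphere d k,
      |‖Matrix.toEuclideanLin (X * R) u‖ ^ 2 - frobNorm X ^ 2| ≤ ε * frobNorm X ^ 2) :
    ProductRIP X R k ε := by
  intro u hu
  have hF : 0 ≤ frobNorm X := Real.sqrt_nonneg _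
  obtain ⟨h1, h2⟩ := abs_le.1 (h u hu)
  have h3 : 0 ≤ ε * frobNorm X ^ 2 := by positivity
  have h4 : ε * (ε * frobNorm X ^ 2) ≤ ε * frobNorm X ^ 2 := mul_le_of_le_one_left h3 hε1
  constructor
  · refine le_of_sq_le_sq ?_ (norm_nonneg _)
    nlinarith
  · refine le_of_sq_le_sq ?_ (by positivity)
    nlinarith

theorem mainTheorem3 :
    ∃ c₀ C c : ℝ, 0 < c₀ ∧ 0 < C ∧ 0 < c ∧
      ∀ (S : Type*) [MeasurableSpace S] (μ : Measure S) [IsProbabilityMeasure μ]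
        (n p d : ℕ) (X : Matrix (Fin n) (Fin p) ℝ) (W G : S → Matrix (Fin p) (Fin d) ℝ)
        (β : unitInterval) (K ε : ℝ) (k : ℕ),
        0 < β → 0 < K → 0 < ε → ε < 1 →
        IsBernoulliSubgaussian μ W G β K →
        C * K ^ 4 * (k / (β * ε ^ 2)) * max 1 (Real.log (d / k)) ≤ stableRank X →
        1 - Real.exp (-(c * β * ε ^ 2 * stableRank X / K ^ 4)) ≤
          μ.real {s | ProductRIP X ((c₀ * Real.sqrt β)⁻¹ • (W s ⊙ G s)) k ε} := by
  set D : ℝ := 1024 * (2048 * 16 * Real.exp 1 ^ 2) with hD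
  have hD0 : 0 < D := by positivity
  refine ⟨1, 10 * D, (2 * D)⁻¹, one_pos, by positivity, by positivity, ?_⟩
  intro S _ μ _ n p d X W G β K ε k hβ' hK hε0 hε1 h hsr
  have hβ : (0 : ℝ) < β := by exact_mod_cast hβ'
  set good := {s | ProductRIP X (((1 : ℝ) * Real.sqrt β)⁻¹ • (W s ⊙ G s)) k ε} with hgood
  have trivial_case : (sparseSphere d k = ∅) → 1 - Real.exp
      (-((2 * D)⁻¹ * β * ε ^ 2 * stableRank X / K ^ 4)) ≤ μ.real good := by
    intro he
    have : good = Set.univ := Set.eq_univ_of_forall fun s u hu => by simp [he] at hu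
    rw [this, probReal_univ]
    linarith [Real.exp_pos (-((2 * D)⁻¹ * β * ε ^ 2 * stableRank X / K ^ 4))]
  rcases Nat.eq_zero_or_pos k with rfl | hk
  · refine trivial_case (Set.eq_empty_of_forall_notMem fun u hu => ?_)
    have h0 : {j | u j ≠ 0} = ∅ := by
      rw [← Set.ncard_eq_zero]; exact Nat.le_zero.1 hu.2
    have : u = 0 := by
      ext j
      by_contra hj
      exact (Set.ext_iff.1 h0 j).1 hj
    have h1 := hu.1
    simp [this] at h1
  rcases isEmpty_or_nonempty (Fin d) with hd | hd
  · refine trivial_case (Set.eq_empty_of_forall_notMem fun u hu => ?_)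
    have h1 := hu.1
    simp [Subsingleton.elim u 0] at h1
  set ℓ := (k : ℝ) * max 1 (Real.log (d / k)) with hℓ
  have hk1 : (1 : ℝ) ≤ k := by exact_mod_cast hk
  have hℓ1 : 1 ≤ ℓ := one_le_mul_of_one_le_of_one_le hk1 (le_max_left _ _)
  set H := β * ε ^ 2 * stableRank X / K ^ 4 with hH
  have hHℓ : 10 * D * ℓ ≤ H := by
    rw [hH, le_div_iff₀ (by positivity)]
    have := mul_le_mul_of_nonneg_left hsr (by positivity : 0 ≤ (β : ℝ) * ε ^ 2)
    refine le_trans (le_of_eq ?_) this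
    rw [hℓ]; field_simp
  have hsr0 : stableRank X ≠ 0 := by
    intro h0
    rw [hH, h0] at hHℓ
    simp only [mul_zero, zero_div] at hHℓ
    have : 0 < 10 * D * ℓ := by positivity
    linarith
  have hF : frobNorm X ≠ 0 := fun h0 => hsr0 (by simp [stableRank, h0])
  have hL : 0 < specNorm X := by
    refine lt_of_le_of_ne ?_ fun h0 => hsr0 (by simp [stableRank, ← h0])
    exact specNorm_nonneg X
  have hp : Nonempty (Fin p × Fin d) := by
    rcases isEmpty_or_nonempty (Fin p) with hp | hp
    · exact absurd (by simp [frobNorm]) hF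
    · exact ⟨(Classical.arbitrary _, Classical.arbitrary _)⟩
  obtain ⟨N, hN1, hNcard, hN⟩ := exists_sparse_net d k hk
  set bad : EuclideanSpace ℝ (Fin d) → Set S := fun y =>
    {s | ε / 32 * frobNorm X ^ 2 < |‖Matrix.toEuclideanLin
        (X * (((1 : ℝ) * Real.sqrt β)⁻¹ • (W s ⊙ G s))) y‖ ^ 2 - frobNorm X ^ 2|} with hbad
  have hcover : (Set.univ : Set S) ⊆ good ∪ ⋃ y ∈ N, bad y := by
    intro s _
    by_cases hs : ∃ y ∈ N, s ∈ bad y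
    · right; simpa using hs
    · left
      push Not at hs
      refine productRIP_of_abs_le hε0.le hε1.le fun u hu => ?_
      have := hN (Matrix.toEuclideanLin (X * (((1 : ℝ) * Real.sqrt β)⁻¹ • (W s ⊙ G s))))
        (frobNorm X ^ 2) (ε / 32 * frobNorm X ^ 2) (fun y hy => not_lt.1 (hs y hy)) u hu
      linarith
  have hbadle : ∀ y ∈ N, μ.real (bad y) ≤ 2 * Real.exp (-(H / D)) := by
    intro y hy
    have h1 := h.measure_deviation_le hK hβ hL hp (hN1 y hy) (t := ε / 32) (by positivity)
      (by linarith)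
    have e : (ε / 32) ^ 2 * β * stableRank X / (2048 * 16 * Real.exp 1 ^ 2 * K ^ 4) = H / D := by
      rw [hH, hD]; field_simp; ring
    rw [e] at h1
    refine ENNReal.toReal_le_of_le_ofReal (by positivity) (h1.trans_eq ?_)
    rw [ENNReal.ofReal_mul (by norm_num), expE]; simp
  have hsum : μ.real (⋃ y ∈ N, bad y) ≤ Real.exp (-(H / (2 * D))) := by
    calc _ ≤ ∑ y ∈ N, μ.real (bad y) := measureReal_biUnion_finset_le N bad
      _ ≤ ∑ y ∈ N, 2 * Real.exp (-(H / D)) := Finset.sum_le_sum hbadle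
      _ = N.card * (2 * Real.exp (-(H / D))) := by rw [Finset.sum_const, nsmul_eq_mul]
      _ ≤ Real.exp (4 * ℓ) * (Real.exp ℓ * Real.exp (-(H / D))) := by
          gcongr
          linarith [Real.add_one_le_exp ℓ]
      _ = Real.exp (4 * ℓ + (ℓ + -(H / D))) := by rw [← Real.exp_add, ← Real.exp_add]
      _ ≤ _ := by
          apply Real.exp_le_exp.2
          have e1 : H / D = 2 * (H / (2 * D)) := by field_simp
          have e2 : 5 * ℓ ≤ H / (2 * D) := by
            rw [le_div_iff₀ (by positivity)]; linarith
          linarith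
  have htot : 1 ≤ μ.real good + μ.real (⋃ y ∈ N, bad y) := by
    rw [← probReal_univ (μ := μ)]
    exact (measureReal_mono hcover).trans (measureReal_union_le _ _)
  have e : (2 * D)⁻¹ * β * ε ^ 2 * stableRank X / K ^ 4 = H / (2 * D) := by
    rw [hH]; field_simp
  rw [e]
  linarith
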